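/- \textbf{Model.} Let $G=(V,E)$ be a directed multigraph with finitely many edges, a source $s$ and a sink $t\neq s$. Each edge $e$ has a transit time $\tau_e\ge 0$, a capacity $\nu_e>0$ and a cost $c_e\ge 0$. There are a constant inflow rate $u>0$ and a deadline $D$. Let $\mathcal P$ be the set of (simple, directed) $s,t$-paths; $G$ is a \emph{parallel path network} if distinct $s,t$-paths are edge-disjoint. A \emph{flow over time} $f$ is given by measurable path inflow rates $f_P^+\ge 0$ ($P\in\mathcal P$) with $\sum_{P} f_P^+(\theta)=u$ for all $\theta\ge 0$, and the edge flows they induce in the deterministic fluid queuing model: if $f_e^+$ is the inflow rate of $e$, its queue $z_e$ is absolutely continuous with $z_e(0)=0$ and, almost everywhere, $z_e'=f_e^+-\nu_e$ where $z_e>0$ and $z_e'=\max\{f_e^+-\nu_e,0\}$ where $z_e=0$. A particle that enters $e$ at time $\theta$ leaves it at time $T_e(\theta)=\theta+z_e(\theta)/\nu_e+\tau_e$. The particle leaving $s$ at time $\theta$ along $P$ reaches the vertices of $P$ at the times given by $\ell^P_s(\theta)=\theta$ and $\ell^P_w(\theta)=T_{e}(\ell^P_v(\theta))$ for edges $e=(v,w)$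 of $P$; and the flow that entered $e=(v,w)$ up to time $\theta$ is $\int_0^\theta f_e^+=\sum_{P\ni e}\int_{\{\xi\ge 0:\,\ell^P_v(\xi)\le\theta\}}f_P^+(\xi)\,d\xi$. Let $c_P(\theta)=\sum_{e\in P}c_e$ if $\ell^P_t(\theta)<D$ and $c_P(\theta)=\infty$ otherwise. The flow $f$ is a \emph{Nash flow} if for all $\theta\ge 0$, $f_P^+(\theta)>0$ implies $c_P(\theta)=\min_{Q\in\mathcal P}c_Q(\theta)$. The amount of flow arriving before time $T$ is $M_f(T)=\sum_P\int_{\{\xi\ge 0:\,\ell_t^P(\xi)<T\}}f_P^+(\xi)\,d\xi$. Put $$M=\min\{M_f(D): f \text{ a Nash flow}\},\qquad D^*(M)=\min\{T\ge 0:\ M_f(T)\ge M\text{ for some flow over time } f\}.$$ The \emph{makespan-price of anarchy} of the instance is $D/D^*(M)$. \textbf{Theorem.} In every parallel path network in which some $s,t$-path $P$ satisfies $\sum_{e\in P}\tau_e<D$ (i.e. some particle can arrive before the deadline), both minima are attained, $D^*(M)>0$, and $$\frac{D}{D^*(M)}\le\frac{e}{e-1},$$ whatever the transit times are. The bound is tight: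 for the (parallel path) network of $n$ parallel links from $s$ to $t$, each of capacity $1/n$ and transit time $0$, with $u=D=1$ and arbitrary edge costs, the makespan-price of anarchy converges to $e/(e-1)$ as $n\to\infty$. -/

import Mathlib

/-- An instance of the deterministic fluid queuing model with costs and a deadline: a directed
multigraph with vertices `V` and edges `E` (an edge `e` leads from `tail e` to `head e`; parallel
edges are allowed), a source, a sink, edge data, a constant network inflow rate and a deadline. -/
structure FlowNetwork (V : Type*) (E : Type*) where
  tail : E → V
  head : E → V
  source : V
  sink : V
  source_ne_sink : source ≠ sink
  /-- transit times `τ_e ≥ 0` -/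
  transitTime : E → ℝ
  transitTime_nonneg : ∀ e, 0 ≤ transitTime e
  /-- capacities `ν_e > 0` -/
  capacity : E → ℝ
  capacity_pos : ∀ e, 0 < capacity e
  /-- costs `c_e ≥ 0` -/
  cost : E → ℝ
  cost_nonneg : ∀ e, 0 ≤ cost e
  /-- the constant rate `u > 0` at which flow departs from the source -/
  inflowRate : ℝ
  inflowRate_pos : 0 < inflowRate
  /-- the deadline `D` -/
  deadline : ℝ

namespace FlowNetwork

/-- The list of edges is a directed walk from `v` to `w`. -/
def IsWalk {V E : Type*} (N : FlowNetwork V E) : V → List E → V → Prop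
  | v, [], w => v = w
  | v, e :: l, w => N.tail e = v ∧ IsWalk N (N.head e) l w

/-- An `s`,`t`-path: a directed walk from the source to the sink that repeats no vertex. -/
@[ext]
structure STPath {V E : Type*} (N : FlowNetwork V E) where
  edges : List E
  isWalk : N.IsWalk N.source edges N.sink
  nodup : (N.source :: edges.map N.head).Nodup

theorem STPath.edges_nodup {V E : Type*} {N : FlowNetwork V E} (P : N.STPath) :
    P.edges.Nodup :=
  (List.nodup_cons.1 P.nodup).2.of_map _

instance {V E : Type*} [Finite E] (N : FlowNetwork V E) : Finite N.STPath := by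
  classical
  have := Fintype.ofFinite E
  refine Finite.of_injective
    (fun P : N.STPath => (⟨P.edges, P.edges_nodup⟩ : {l : List E // l.Nodup})) ?_
  intro P Q h
  exact STPath.ext (congrArg Subtype.val h)

noncomputable instance {V E : Type*} [Finite E] (N : FlowNetwork V E) : Fintype N.STPath :=
  Fintype.ofFinite _

/-- The cost `c_P` of a path. -/
def STPath.cost {V E : Type*} {N : FlowNetwork V E} (P : N.STPath) : ℝ :=
  (P.edges.map N.cost).sum

/-- The total transit time of a path. -/
def STPath.transitTime {V E : Type*} {N : FlowNetwork V E} (P : N.STPath) : ℝ :=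
  (P.edges.map N.transitTime).sum

/-- A parallel path network: distinct `s`,`t`-paths have no edge in common. -/
def IsParallelPathNetwork {V E : Type*} (N : FlowNetwork V E) : Prop :=
  ∀ P Q : N.STPath, P ≠ Q → P.edges.Disjoint Q.edges

/-- `z` is the mass of the queue of an edge with capacity `ν` and inflow rate `f`, starting empty
at time `0`: it is (absolutely) continuous and its derivative is `f - ν` where `z > 0` and
`max (f - ν) 0` where `z = 0`. -/
def IsQueue (ν : ℝ) (f z : ℝ → ℝ) : Prop :=
  ContinuousOn z (Set.Ici 0) ∧
    ∀ θ, 0 ≤ θ → z θ = ∫ x in (0 : ℝ)..θ, if 0 < z x then f x - ν else max (f x - ν) 0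

/-- The time `T_e(θ) = θ + z_e(θ) / ν_e + τ_e` at which a particle that enters the edge `e` at
time `θ` leaves it, given the queues `z`. -/
noncomputable def exitTime {V E : Type*} (N : FlowNetwork V E) (z : E → ℝ → ℝ) (e : E) (θ : ℝ) :
    ℝ :=
  θ + z e θ / N.capacity e + N.transitTime e

open Classical in
/-- The time `ℓ^P_v(θ)` at which a particle that leaves the source at time `θ` along `P` arrives
at the vertex `v` of `P`, given the queues `z`: the exit times of the edges of `P` before `v` are
applied one after the other. -/
noncomputable def arrivalTime {V E : Type*} (N : FlowNetwork V E) (z : E → ℝ → ℝ) (P : N.STPath)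
    (v : V) (θ : ℝ) : ℝ :=
  (P.edges.takeWhile (fun e => N.tail e ≠ v)).foldl (fun t e => N.exitTime z e t) θ

open Classical in
/-- A flow over time: inflow rates into the `s`,`t`-paths that add up to the network inflow rate,
with the edge inflow rates and queues that they induce. -/
structure FlowOverTime {V E : Type*} [Finite E] (N : FlowNetwork V E) where
  /-- the path inflow rates `f_P^+` -/
  pathInflow : N.STPath → ℝ → ℝ
  pathInflow_measurable : ∀ P, Measurable (pathInflow P)
  pathInflow_nonneg : ∀ P θ, 0 ≤ θ → 0 ≤ pathInflow P θ
  sum_pathInflow : ∀ θ, 0 ≤ θ → ∑ P, pathInflow P θ = N.inflowRate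
  /-- the edge inflow rates `f_e^+` -/
  edgeInflow : E → ℝ → ℝ
  edgeInflow_nonneg : ∀ e θ, 0 ≤ θ → 0 ≤ edgeInflow e θ
  edgeInflow_integrable : ∀ e θ, 0 ≤ θ →
    IntervalIntegrable (edgeInflow e) MeasureTheory.volume 0 θ
  /-- the queue masses `z_e` -/
  queue : E → ℝ → ℝ
  isQueue : ∀ e, IsQueue (N.capacity e) (edgeInflow e) (queue e)
  /-- The flow that has entered an edge up to time `θ` consists, for each path through the edge, of
  the particles on the path that have reached the tail of the edge up to time `θ`. -/
  integral_edgeInflow : ∀ e θ, 0 ≤ θ →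
    ∫ x in (0 : ℝ)..θ, edgeInflow e x =
      ∑ P : N.STPath with e ∈ P.edges,
        ∫ ξ in {ξ : ℝ | 0 ≤ ξ ∧ N.arrivalTime queue P (N.tail e) ξ ≤ θ}, pathInflow P ξ

namespace FlowOverTime

variable {V E : Type*} [Finite E] {N : FlowNetwork V E}

/-- The time `ℓ^P_t(θ)` at which particle `θ` arrives at the sink when it uses `P`. -/
noncomputable def sinkArrival (f : N.FlowOverTime) (P : N.STPath) (θ : ℝ) : ℝ :=
  N.arrivalTime f.queue P N.sink θ

open Classical in
/-- The cost `c_P(θ)` of particle `θ` along `P`: `c_P` if it arrives before the deadline, `∞`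
otherwise. -/
noncomputable def particleCost (f : N.FlowOverTime) (P : N.STPath) (θ : ℝ) : WithTop ℝ :=
  if f.sinkArrival P θ < N.deadline then (P.cost : WithTop ℝ) else ⊤

/-- A Nash flow: at all times, only paths that minimize the particle cost have positive inflow. -/
def IsNash (f : N.FlowOverTime) : Prop :=
  ∀ θ, 0 ≤ θ → ∀ P, 0 < f.pathInflow P θ → ∀ Q, f.particleCost P θ ≤ f.particleCost Q θ

/-- The amount of flow that arrives at the sink before time `T`. -/
noncomputable def throughput (f : N.FlowOverTime) (T : ℝ) : ℝ :=
  ∑ P : N.STPath, ∫ ξ in {ξ : ℝ | 0 ≤ ξ ∧ f.sinkArrival P ξ < T}, f.pathInflow P ξ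

end FlowOverTime

section PriceOfAnarchy

variable {V E : Type*} [Finite E] (N : FlowNetwork V E)

/-- The amounts `M_f` of flow that arrive before the deadline, over all Nash flows `f`. -/
def nashThroughputs : Set ℝ :=
  {M | ∃ f : N.FlowOverTime, f.IsNash ∧ f.throughput N.deadline = M}

/-- `M`, the smallest amount of flow that arrives before the deadline over all Nash flows. -/
noncomputable def minNashThroughput : ℝ := sInf N.nashThroughputs

/-- The points in time before which some flow over time brings `M` units of flow to the sink. -/
def feasibleMakespans (M : ℝ) : Set ℝ :=
  {T | 0 ≤ T ∧ ∃ f : N.FlowOverTime, M ≤ f.throughput T}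

/-- `D^*(M)`, the earliest time by which `M` units of flow can reach the sink. -/
noncomputable def optimalMakespan (M : ℝ) : ℝ := sInf (N.feasibleMakespans M)

/-- The makespan-price of anarchy `D / D^*(M)`. -/
noncomputable def makespanPoA : ℝ := N.deadline / N.optimalMakespan N.minNashThroughput

end PriceOfAnarchy

/-- `n` parallel links from `false` to `true`, each with capacity `1 / n` and transit time `0`,
with network inflow rate `1`, deadline `1` and edge costs `c`. -/
noncomputable def parallelLinks (n : ℕ) (c : Fin n → NNReal) : FlowNetwork Bool (Fin n) where
  tail _ := false
  head _ := true
  source := false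
  sink := true
  source_ne_sink := by decide
  transitTime _ := 0
  transitTime_nonneg _ := le_rfl
  capacity _ := 1 / (n : ℝ)
  capacity_pos e := one_div_pos.2 (Nat.cast_pos.2 e.pos)
  cost e := (c e : ℝ)
  cost_nonneg e := (c e).2
  inflowRate := 1
  inflowRate_pos := one_pos
  deadline := 1

end FlowNetwork

namespace FlowNetwork

open MeasureTheory Set

/-! Since paths share no edges, each path `P` behaves like one queue at its bottleneck. With `F` the
cumulative inflow into `P`, its total transit time `τ_P` and its least capacity `ν_P`, a particle
leaving at `θ` arrives at `max_{s ≤ θ} (τ_P + s + (F θ - F s) / ν_P)`, up to the harmless extra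
bound `τ_P + θ` (`TravelBounds`). The rest of the argument uses only these inequalities.

Nash flows: let `Θ` be the first time at which every path misses the deadline `D`. Until then no
flow is sent late, so the throughput is `u * Θ`. The value `Θ` is smallest when the paths are used
up one at a time, in some order of increasing cost, because a path that receives all of the inflow
builds up its queue as early as possible. Starting at `t`, this takes `share * max (slack - t) 0`
with `share = min 1 (ν_P / u)` and `slack = D - τ_P`. Hence the minimum is `u` times the least
`seqUseUp` over the finitely many cost orders: `seqUseUp_le_of_budget` gives the lower bound, and
`IsCostOrder.exists_isNash` realizes every order.

Optimum: any flow satisfies `throughput T ≤ u * t + ∑ ν_P * max (T - τ_P - t) 0` for every `t ≥ 0`,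
and a single greedy constant flow meets the best of these bounds for every `T`. So the feasible
makespans form a closed set and the optimum is attained.

Ratio: if using up a path takes the time from `a` to `a'`, then for `x ≥ a'` it adds at most `(D -
x) * (a' - a) / (D - a)` to `∑ share * max (slack - x) 0`. Comparing with a logarithm, the sum is at
most `(D - x) * log (D / (D - Θ))`. With `t` chosen so that `x = max Θ (D - T)`, the throughput
bound forces `D - T ≤ (D - Θ) * log (D / (D - Θ)) ≤ D / e`. For `n` links of capacity `1 / n`, both
`Θ` and the optimum equal `1 - (1 - 1 / n) ^ n`. -/

theorem exists_last_mem_closed {z : ℝ → ℝ} (hz : ContinuousOn z (Ici 0)) {C : Set ℝ}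
    (hC : IsClosed C) (h0 : z 0 ∈ C) {θ : ℝ} (hθ : 0 ≤ θ) :
    ∃ t, 0 ≤ t ∧ t ≤ θ ∧ z t ∈ C ∧ ∀ x, t < x → x ≤ θ → z x ∉ C := by
  have hcl : IsClosed (Icc 0 θ ∩ z ⁻¹' C) :=
    (hz.mono Icc_subset_Ici_self).preimage_isClosed_of_isClosed isClosed_Icc hC
  have hcp : IsCompact (Icc 0 θ ∩ z ⁻¹' C) :=
    isCompact_Icc.of_isClosed_subset hcl inter_subset_left
  obtain ⟨t, ht, hmax⟩ := hcp.exists_isGreatest ⟨0, ⟨le_rfl, hθ⟩, h0⟩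
  refine ⟨t, ht.1.1, ht.1.2, ht.2, fun x htx hxθ hx => ?_⟩
  exact absurd (hmax ⟨⟨ht.1.1.trans htx.le, hxθ⟩, hx⟩) (not_le.2 htx)

/-! ### Queues and exit times of a single edge -/

section Queue

variable {ν : ℝ} {f z : ℝ → ℝ}

/-- The growth rate of a queue. -/
noncomputable def queueRate (ν : ℝ) (f z : ℝ → ℝ) (x : ℝ) : ℝ :=
  if 0 < z x then f x - ν else max (f x - ν) 0

theorem queueRate_intervalIntegrable (hz : ContinuousOn z (Ici 0))
    (hf : ∀ θ, 0 ≤ θ → IntervalIntegrable f volume 0 θ) {s θ : ℝ} (hs : 0 ≤ s) (hθ : 0 ≤ θ) :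
    IntervalIntegrable (queueRate ν f z) volume s θ := by
  have key : ∀ θ, 0 ≤ θ → IntervalIntegrable (queueRate ν f z) volume 0 θ := by
    intro θ hθ
    have hf' : IntervalIntegrable (fun x => f x - ν) volume 0 θ :=
      (hf θ hθ).sub intervalIntegrable_const
    rw [intervalIntegrable_iff_integrableOn_Ioc_of_le hθ] at hf' ⊢
    -- `z` is continuous only on `[0, ∞)`; clamping the argument gives a globally continuous
    -- function that agrees with it there.
    have hc : Continuous (fun x => z (max 0 x)) :=
      hz.comp_continuous (continuous_const.max continuous_id) (fun x => mem_Ici.2 (le_max_left 0 x))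
    have hm : MeasurableSet {x | 0 < z (max 0 x)} := (isOpen_lt continuous_const hc).measurableSet
    have h2 : IntegrableOn (fun x => max (f x - ν) 0) (Ioc 0 θ) := hf'.pos_part
    have h3 := Integrable.piecewise (μ := volume.restrict (Ioc 0 θ)) hm hf'.integrableOn
      (h2.integrableOn)
    refine h3.congr ?_
    filter_upwards [ae_restrict_mem measurableSet_Ioc] with x hx
    simp only [queueRate, Set.piecewise, mem_ofPred_eq, max_eq_right hx.1.le]
  exact (key s hs).symm.trans (key θ hθ)

theorem IsQueue.sub_eq (h : IsQueue ν f z)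
    (hf : ∀ θ, 0 ≤ θ → IntervalIntegrable f volume 0 θ) {s θ : ℝ} (hs : 0 ≤ s) (hθ : 0 ≤ θ) :
    z θ - z s = ∫ x in s..θ, queueRate ν f z x := by
  have h1 := h.2 s hs
  have h2 := h.2 θ hθ
  have := intervalIntegral.integral_add_adjacent_intervals
    (queueRate_intervalIntegrable (ν := ν) h.1 hf le_rfl hs)
    (queueRate_intervalIntegrable (ν := ν) h.1 hf hs hθ)
  change z s = ∫ x in (0 : ℝ)..s, queueRate ν f z x at h1
  change z θ = ∫ x in (0 : ℝ)..θ, queueRate ν f z x at h2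
  linarith

theorem IsQueue.zero (h : IsQueue ν f z) : z 0 = 0 := by
  simpa using h.2 0 le_rfl

/-- After the last time at which `z ≥ 0` the queue would be negative, but there its growth rate is a
maximum with `0`. -/
theorem IsQueue.nonneg (h : IsQueue ν f z)
    (hf : ∀ θ, 0 ≤ θ → IntervalIntegrable f volume 0 θ) {θ : ℝ} (hθ : 0 ≤ θ) : 0 ≤ z θ := by
  obtain ⟨t, ht0, htθ, htz, hlast⟩ :=
    exists_last_mem_closed h.1 (isClosed_Ici (a := (0 : ℝ))) (by simp [h.zero]) hθ
  have h1 := h.sub_eq hf ht0 hθ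
  have h2 : 0 ≤ ∫ x in t..θ, queueRate ν f z x := by
    rw [intervalIntegral.integral_of_le htθ]
    refine setIntegral_nonneg measurableSet_Ioc fun x hx => ?_
    have : ¬ 0 < z x := fun hlt => hlast x hx.1 hx.2 hlt.le
    simp [queueRate, this]
  have : 0 ≤ z t := htz
  linarith

theorem integral_sub_const_eq (hf : ∀ θ, 0 ≤ θ → IntervalIntegrable f volume 0 θ) {s θ : ℝ}
    (hs : 0 ≤ s) (hθ : 0 ≤ θ) :
    ∫ x in s..θ, (f x - ν) =
      (∫ x in (0 : ℝ)..θ, f x) - (∫ x in (0 : ℝ)..s, f x) - ν * (θ - s) := by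
  have hi : IntervalIntegrable f volume s θ := (hf s hs).symm.trans (hf θ hθ)
  rw [intervalIntegral.integral_sub hi intervalIntegrable_const,
    ← intervalIntegral.integral_add_adjacent_intervals (hf s hs) hi]
  simp
  ring

theorem IsQueue.le_sub (h : IsQueue ν f z)
    (hf : ∀ θ, 0 ≤ θ → IntervalIntegrable f volume 0 θ) {s θ : ℝ} (hs : 0 ≤ s) (hsθ : s ≤ θ) :
    (∫ x in (0 : ℝ)..θ, f x) - (∫ x in (0 : ℝ)..s, f x) - ν * (θ - s) ≤ z θ - z s := by
  have hθ := hs.trans hsθ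
  rw [h.sub_eq hf hs hθ, ← integral_sub_const_eq hf hs hθ]
  refine intervalIntegral.integral_mono_on hsθ ?_
    (queueRate_intervalIntegrable (ν := ν) h.1 hf hs hθ) fun x _ => ?_
  · exact ((hf s hs).symm.trans (hf θ hθ)).sub intervalIntegrable_const
  · unfold queueRate
    split_ifs
    · exact le_rfl
    · exact le_max_left _ _

/-- Since the queue was last empty, the edge has worked at full capacity, so the growth rate is
exactly `f - ν`. Together with `IsQueue.le_sub` this describes the queue as a maximum over starting
times. -/
theorem IsQueue.exists_last_empty (h : IsQueue ν f z)
    (hf : ∀ θ, 0 ≤ θ → IntervalIntegrable f volume 0 θ) {θ : ℝ} (hθ : 0 ≤ θ) :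
    ∃ t, 0 ≤ t ∧ t ≤ θ ∧
      z θ = (∫ x in (0 : ℝ)..θ, f x) - (∫ x in (0 : ℝ)..t, f x) - ν * (θ - t) := by
  obtain ⟨t, ht0, htθ, htz, hlast⟩ :=
    exists_last_mem_closed h.1 (isClosed_singleton (x := (0 : ℝ))) (by simp [h.zero]) hθ
  refine ⟨t, ht0, htθ, ?_⟩
  have h1 := h.sub_eq hf ht0 hθ
  rw [htz, sub_zero] at h1
  rw [h1, ← integral_sub_const_eq hf ht0 hθ, intervalIntegral.integral_of_le htθ,
    intervalIntegral.integral_of_le htθ]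
  refine setIntegral_congr_fun measurableSet_Ioc fun x hx => ?_
  have : 0 < z x :=
    lt_of_le_of_ne (h.nonneg hf (ht0.trans hx.1.le)) fun h0 => hlast x hx.1 hx.2 h0.symm
  simp [queueRate, this]

end Queue

/-- Continuous nondecreasing maps of times that do not go back in time. -/
structure IsTimeMap (φ : ℝ → ℝ) : Prop where
  continuousOn : ContinuousOn φ (Ici 0)
  monotoneOn : MonotoneOn φ (Ici 0)
  le_apply : ∀ x, 0 ≤ x → x ≤ φ x

theorem IsTimeMap.id : IsTimeMap (fun x => x) :=
  ⟨continuousOn_id, monotone_id.monotoneOn _, fun _ _ => le_rfl⟩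

theorem IsTimeMap.mapsTo {φ : ℝ → ℝ} (h : IsTimeMap φ) : MapsTo φ (Ici 0) (Ici 0) :=
  fun x hx => le_trans hx (h.le_apply x hx)

theorem IsTimeMap.comp {φ ψ : ℝ → ℝ} (hψ : IsTimeMap ψ) (hφ : IsTimeMap φ) :
    IsTimeMap (fun x => ψ (φ x)) :=
  ⟨hψ.continuousOn.comp hφ.continuousOn hφ.mapsTo,
    fun _ hx _ hy hxy => hψ.monotoneOn (hφ.mapsTo hx) (hφ.mapsTo hy) (hφ.monotoneOn hx hy hxy),
    fun x hx => (hφ.le_apply x hx).trans (hψ.le_apply _ (hφ.mapsTo hx))⟩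

theorem IsTimeMap.setOf_le {φ : ℝ → ℝ} (h : IsTimeMap φ) (t : ℝ) :
    {x | 0 ≤ x ∧ φ x ≤ t} = ∅ ∨ ∃ r, 0 ≤ r ∧ φ r ≤ t ∧ {x | 0 ≤ x ∧ φ x ≤ t} = Icc 0 r := by
  rcases lt_or_ge t (φ 0) with ht | ht
  · left
    ext x
    simp only [mem_ofPred_eq, mem_empty_iff_false, iff_false, not_and, not_le]
    exact fun hx => ht.trans_le (h.monotoneOn self_mem_Ici hx hx)
  · right
    have ht0 : 0 ≤ t := (h.le_apply 0 le_rfl).trans ht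
    obtain ⟨r, hr0, hrt, hr, hlast⟩ :=
      exists_last_mem_closed h.continuousOn (isClosed_Iic (a := t)) ht ht0
    refine ⟨r, hr0, hr, ?_⟩
    ext x
    simp only [mem_ofPred_eq, mem_Icc]
    refine and_congr_right fun hx => ⟨fun hxt => ?_, fun hxr => ?_⟩
    · by_contra! hlt
      exact hlast x hlt ((h.le_apply x hx).trans hxt) hxt
    · exact (h.monotoneOn hx hr0 hxr).trans hr

/-- No overtaking: a queue shrinks at rate at most `ν`, so its waiting time decreases at rate at
most one. -/
theorem IsQueue.isTimeMap_exit {ν τ : ℝ} {f z : ℝ → ℝ} (h : IsQueue ν f z) (hν : 0 < ν)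
    (hτ : 0 ≤ τ) (hf0 : ∀ θ, 0 ≤ θ → 0 ≤ f θ)
    (hf : ∀ θ, 0 ≤ θ → IntervalIntegrable f volume 0 θ) :
    IsTimeMap (fun θ => θ + z θ / ν + τ) := by
  refine ⟨(continuousOn_id.add (h.1.div_const ν)).add continuousOn_const, ?_, ?_⟩
  · intro s hs θ hθ hsθ
    have h1 := h.le_sub hf hs hsθ
    have h2 : 0 ≤ (∫ x in (0 : ℝ)..θ, f x) - (∫ x in (0 : ℝ)..s, f x) := by
      rw [intervalIntegral.integral_interval_sub_left (hf θ hθ) (hf s hs)]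
      exact intervalIntegral.integral_nonneg hsθ fun x hx => hf0 x (le_trans hs hx.1)
    have h3 : z s - ν * (θ - s) ≤ z θ  := by linarith [mem_Ici.1 hs]
    have h4 : (z s - ν * (θ - s)) / ν ≤ z θ / ν := by gcongr
    have h5 : (z s - ν * (θ - s)) / ν = z s / ν - (θ - s) := by field_simp
    simp only
    linarith
  · intro x hx
    have := div_nonneg (h.nonneg hf hx) hν.le
    linarith

end FlowNetwork

/-! ### Travel times along a list of edges -/

namespace FlowNetwork

open MeasureTheory Set

theorem monotoneOn_integral {f : ℝ → ℝ} (hf0 : ∀ θ, 0 ≤ θ → 0 ≤ f θ)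
    (hf : ∀ θ, 0 ≤ θ → IntervalIntegrable f volume 0 θ) :
    MonotoneOn (fun θ => ∫ x in (0 : ℝ)..θ, f x) (Ici 0) := by
  intro s hs θ hθ hsθ
  have h2 : 0 ≤ (∫ x in (0 : ℝ)..θ, f x) - (∫ x in (0 : ℝ)..s, f x) := by
    rw [intervalIntegral.integral_interval_sub_left (hf θ hθ) (hf s hs)]
    exact intervalIntegral.integral_nonneg hsθ fun x hx => hf0 x (le_trans hs hx.1)
  simpa using h2

theorem setIntegral_Icc_zero {f : ℝ → ℝ} {r : ℝ} (hr : 0 ≤ r) :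
    ∫ x in Icc 0 r, f x = ∫ x in (0 : ℝ)..r, f x := by
  rw [integral_Icc_eq_integral_Ioc, intervalIntegral.integral_of_le hr]

/-- Exit times stand still only while the queue drains at the full rate `ν`, that is, while nothing
enters. This makes cumulative flow well defined as a function of arrival time. -/
theorem IsQueue.integral_eq_of_exit_eq {ν τ : ℝ} {f z : ℝ → ℝ} (h : IsQueue ν f z) (hν : 0 < ν)
    (hf0 : ∀ θ, 0 ≤ θ → 0 ≤ f θ)
    (hf : ∀ θ, 0 ≤ θ → IntervalIntegrable f volume 0 θ) {s θ : ℝ} (hs : 0 ≤ s) (hsθ : s ≤ θ)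
    (heq : s + z s / ν + τ = θ + z θ / ν + τ) :
    ∫ x in (0 : ℝ)..s, f x = ∫ x in (0 : ℝ)..θ, f x := by
  have h1 := h.le_sub hf hs hsθ
  have h2 := monotoneOn_integral hf0 hf hs (hs.trans hsθ) hsθ
  have h3 : z θ - z s = - (ν * (θ - s)) := by
    have : z θ / ν - z s / ν = -(θ - s) := by linarith
    field_simp at this
    linarith
  simp only at h2
  linarith

variable {V E : Type*}

/-- The time at which a particle that starts at time `θ` has traversed a list of edges. -/
noncomputable def traverse (N : FlowNetwork V E) (z : E → ℝ → ℝ) (L : List E) (θ : ℝ) : ℝ :=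
  L.foldl (fun t e => N.exitTime z e t) θ

/-- The edges of a list are loaded one after the other with the inflow rate `f`. -/
def IsLoaded (N : FlowNetwork V E) (inflow z : E → ℝ → ℝ) (L : List E) (f : ℝ → ℝ) : Prop :=
  ∀ L₁ e L₂, L = L₁ ++ e :: L₂ →
    (∀ θ, 0 ≤ θ → 0 ≤ inflow e θ) ∧
    (∀ θ, 0 ≤ θ → IntervalIntegrable (inflow e) volume 0 θ) ∧
    IsQueue (N.capacity e) (inflow e) (z e) ∧
    ∀ θ, 0 ≤ θ → ∫ x in (0 : ℝ)..θ, inflow e x =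
      ∫ ξ in {ξ : ℝ | 0 ≤ ξ ∧ N.traverse z L₁ ξ ≤ θ}, f ξ

variable {N : FlowNetwork V E} {inflow z : E → ℝ → ℝ} {f : ℝ → ℝ}

theorem traverse_concat (L : List E) (e : E) (θ : ℝ) :
    N.traverse z (L ++ [e]) θ = N.exitTime z e (N.traverse z L θ) := by
  simp [traverse]

theorem IsLoaded.of_append {L L' : List E} (h : N.IsLoaded inflow z (L ++ L') f) :
    N.IsLoaded inflow z L f :=
  fun L₁ e' L₂ hL => h L₁ e' (L₂ ++ L') (by simp [hL])

/-- The sublevel set of `φ` may extend beyond `θ`, but only over a stretch where `φ` is constant,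
and there `f` adds no mass. -/
theorem setIntegral_setOf_timeMap_le {φ : ℝ → ℝ} (hφ : IsTimeMap φ)
    (hc : ∀ s θ, 0 ≤ s → s ≤ θ → φ s = φ θ →
      ∫ x in (0 : ℝ)..s, f x = ∫ x in (0 : ℝ)..θ, f x) {θ : ℝ} (hθ : 0 ≤ θ) :
    ∫ ξ in {ξ : ℝ | 0 ≤ ξ ∧ φ ξ ≤ φ θ}, f ξ = ∫ x in (0 : ℝ)..θ, f x := by
  have hmem : θ ∈ {ξ : ℝ | 0 ≤ ξ ∧ φ ξ ≤ φ θ} := ⟨hθ, le_rfl⟩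
  rcases hφ.setOf_le (φ θ) with h | ⟨r, hr0, hr, h⟩
  · rw [h] at hmem
    exact absurd hmem (notMem_empty _)
  · rw [h] at hmem ⊢
    rw [setIntegral_Icc_zero hr0]
    exact (hc θ r hθ hmem.2 (le_antisymm (hφ.monotoneOn hθ hr0 hmem.2) hr)).symm

/-- How the arrival times at the end of a list of edges depend on the inflow rate. -/
structure TravelBounds (N : FlowNetwork V E) (L : List E) (f φ : ℝ → ℝ) : Prop where
  isTimeMap : IsTimeMap φ
  integral_eq : ∀ s θ, 0 ≤ s → s ≤ θ → φ s = φ θ →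
      ∫ x in (0 : ℝ)..s, f x = ∫ x in (0 : ℝ)..θ, f x
  add_le : ∀ θ, 0 ≤ θ → (L.map N.transitTime).sum + θ ≤ φ θ
  lower : ∀ e ∈ L, ∀ s θ, 0 ≤ s → s ≤ θ → (L.map N.transitTime).sum + s +
      ((∫ x in (0 : ℝ)..θ, f x) - ∫ x in (0 : ℝ)..s, f x) / N.capacity e ≤ φ θ
  upper : ∀ m, 0 < m → (∀ e ∈ L, m ≤ N.capacity e) → ∀ θ, 0 ≤ θ → ∃ s, 0 ≤ s ∧ s ≤ θ ∧
      φ θ ≤ (L.map N.transitTime).sum + s +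
        ((∫ x in (0 : ℝ)..θ, f x) - ∫ x in (0 : ℝ)..s, f x) / m

/-- Induction on the last edge. The flow that has entered it by the arrival of particle `θ` is
exactly the flow that has left the source by `θ` (`hA`), so queue estimates at the last edge become
estimates in source time. -/
theorem IsLoaded.travelBounds (hf0 : ∀ θ, 0 ≤ θ → 0 ≤ f θ)
    (hf : ∀ θ, 0 ≤ θ → IntervalIntegrable f volume 0 θ) (L : List E)
    (h : N.IsLoaded inflow z L f) : N.TravelBounds L f (N.traverse z L) := by
  induction L using List.reverseRecOn with
  | nil =>
    refine ⟨IsTimeMap.id, ?_, ?_, by simp, ?_⟩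
    · intro s θ _ _ hst
      have : s = θ := hst
      rw [this]
    · intro θ _
      simp [traverse]
    · intro m _ _ θ hθ
      exact ⟨θ, hθ, le_rfl, by simp [traverse]⟩
  | append_singleton L e ih =>
    have ih := ih h.of_append
    obtain ⟨hg0, hg, hq, hint⟩ := h L e [] rfl
    have hν := N.capacity_pos e
    have hT : IsTimeMap (N.exitTime z e) :=
      hq.isTimeMap_exit hν (N.transitTime_nonneg e) hg0 hg
    have hφ := ih.isTimeMap
    have hA : ∀ θ, 0 ≤ θ → ∫ x in (0 : ℝ)..(N.traverse z L θ), inflow e x =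
        ∫ x in (0 : ℝ)..θ, f x := by
      intro θ hθ
      rw [hint _ (hφ.mapsTo hθ)]
      exact setIntegral_setOf_timeMap_le hφ ih.integral_eq hθ
    have hfun : N.traverse z (L ++ [e]) = fun θ => N.exitTime z e (N.traverse z L θ) :=
      funext fun θ => traverse_concat L e θ
    have hsum : ((L ++ [e]).map N.transitTime).sum =
        (L.map N.transitTime).sum + N.transitTime e := by simp
    rw [hfun]
    have hz : ∀ θ, 0 ≤ θ → N.traverse z L θ + N.transitTime e ≤
        N.exitTime z e (N.traverse z L θ) := by
      intro θ hθ
      have := div_nonneg (hq.nonneg hg (hφ.mapsTo hθ)) hν.le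
      unfold exitTime
      linarith
    refine ⟨hT.comp hφ, ?_, ?_, ?_, ?_⟩
    · intro s θ hs hsθ heq
      have hθ := hs.trans hsθ
      rw [← hA s hs, ← hA θ hθ]
      exact hq.integral_eq_of_exit_eq hν hg0 hg (hφ.mapsTo hs) (hφ.monotoneOn hs hθ hsθ) heq
    · intro θ hθ
      have := ih.add_le θ hθ
      rw [hsum]
      linarith [hz θ hθ]
    · intro e' he' s θ hs hsθ
      have hθ := hs.trans hsθ
      rw [hsum]
      rcases List.mem_append.1 he' with he' | he'
      · have := ih.lower e' he' s θ hs hsθ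
        linarith [hz θ hθ]
      · obtain rfl := List.mem_singleton.1 he'
        have h1 := hq.le_sub hg (hφ.mapsTo hs) (hφ.monotoneOn hs hθ hsθ)
        rw [hA s hs, hA θ hθ] at h1
        have h2 := hq.nonneg hg (hφ.mapsTo hs)
        have h3 := ih.add_le s hs
        have h4 : ((∫ x in (0 : ℝ)..θ, f x) - ∫ x in (0 : ℝ)..s, f x) / N.capacity e' ≤
            z e' (N.traverse z L θ) / N.capacity e' + (N.traverse z L θ - N.traverse z L s) := by
          rw [div_le_iff₀ hν, add_mul, div_mul_cancel₀ _ hν.ne']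
          linarith
        unfold exitTime
        linarith
    · intro m hm hmL θ hθ
      have hme : m ≤ N.capacity e := hmL e (by simp)
      have hφθ := hφ.mapsTo hθ
      obtain ⟨t, ht0, htθ, htz⟩ := hq.exists_last_empty hg hφθ
      -- Translate the last empty time `t` of the final queue into a departure time `r`. If `t`
      -- precedes the first possible arrival, nothing has entered yet and `r = 0` serves.
      obtain ⟨r, hr0, hrθ, htr, hAr⟩ : ∃ r, 0 ≤ r ∧ r ≤ θ ∧ t ≤ N.traverse z L r ∧
          ∫ x in (0 : ℝ)..r, f x = ∫ x in (0 : ℝ)..t, inflow e x := by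
        rcases le_total t (N.traverse z L 0) with ht | ht
        · refine ⟨0, le_rfl, hθ, ht, ?_⟩
          have h1 := monotoneOn_integral hg0 hg ht0 (hφ.mapsTo self_mem_Ici) ht
          have h2 := monotoneOn_integral hg0 hg self_mem_Ici ht0 ht0
          have h3 := hA 0 le_rfl
          simp only [intervalIntegral.integral_same] at h1 h2 h3 ⊢
          linarith
        · obtain ⟨r, hr, hrt⟩ := intermediate_value_Icc hθ
            (hφ.continuousOn.mono Icc_subset_Ici_self) ⟨ht, htθ⟩
          exact ⟨r, hr.1, hr.2, hrt.ge, by rw [← hA r hr.1, hrt]⟩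
      -- The induction hypothesis is applied at `r` rather than `θ`; the waiting bounds over `[s,
      -- r]` and `[r, θ]` then telescope with the common divisor `m`.
      obtain ⟨s, hs0, hsr, hs⟩ := ih.upper m hm (fun e' he' => hmL e' (by simp [he'])) r hr0
      refine ⟨s, hs0, hsr.trans hrθ, ?_⟩
      rw [hA θ hθ, ← hAr] at htz
      have hmono := monotoneOn_integral hf0 hf hr0 hθ hrθ
      simp only at hmono
      have h1 : z e (N.traverse z L θ) / N.capacity e =
          ((∫ x in (0 : ℝ)..θ, f x) - ∫ x in (0 : ℝ)..r, f x) / N.capacity e -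
            (N.traverse z L θ - t) := by
        rw [htz]
        field_simp
      have h2 : ((∫ x in (0 : ℝ)..θ, f x) - ∫ x in (0 : ℝ)..r, f x) / N.capacity e ≤
          ((∫ x in (0 : ℝ)..θ, f x) - ∫ x in (0 : ℝ)..r, f x) / m :=
        div_le_div_of_nonneg_left (by linarith) hm hme
      have h3 : ((∫ x in (0 : ℝ)..θ, f x) - ∫ x in (0 : ℝ)..r, f x) / m +
          ((∫ x in (0 : ℝ)..r, f x) - ∫ x in (0 : ℝ)..s, f x) / m =
          ((∫ x in (0 : ℝ)..θ, f x) - ∫ x in (0 : ℝ)..s, f x) / m := by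
        rw [← add_div]
        ring_nf
      rw [hsum]
      unfold exitTime
      linarith

section Walk

theorem isWalk_append {v w : V} (L₁ L₂ : List E) :
    N.IsWalk v (L₁ ++ L₂) w ↔ ∃ m, N.IsWalk v L₁ m ∧ N.IsWalk m L₂ w := by
  induction L₁ generalizing v with
  | nil => simp [IsWalk]
  | cons e L ih => simp [IsWalk, ih, and_assoc]

theorem IsWalk.end_mem {v w : V} {L : List E} (h : N.IsWalk v L w) (hL : L ≠ []) :
    w ∈ L.map N.head := by
  induction L generalizing v with
  | nil => exact absurd rfl hL
  | cons e L ih =>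
    rcases L with _ | ⟨e', L'⟩
    · simp [show N.head e = w from h.2]
    · exact List.mem_cons_of_mem _ (ih h.2 (by simp))

theorem IsWalk.tail_ne {v w : V} {L : List E} (h : N.IsWalk v L w)
    (hn : (v :: L.map N.head).Nodup) : ∀ e ∈ L, N.tail e ≠ w := by
  induction L generalizing v with
  | nil => simp
  | cons e L ih =>
    intro e' he'
    rcases List.mem_cons.1 he' with rfl | he'
    · rintro rfl
      have := h.end_mem (by simp)
      rw [h.1] at this
      exact (List.nodup_cons.1 hn).1 this
    · exact ih h.2 (List.nodup_cons.1 hn).2 e' he'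

theorem arrivalTime_sink (z : E → ℝ → ℝ) (P : N.STPath) :
    N.arrivalTime z P N.sink = N.traverse z P.edges := by
  ext θ
  unfold arrivalTime traverse
  rw [List.takeWhile_eq_self_iff.2]
  intro e he
  simpa using P.isWalk.tail_ne P.nodup e he

theorem arrivalTime_tail (z : E → ℝ → ℝ) (P : N.STPath) {L₁ L₂ : List E} {e : E}
    (h : P.edges = L₁ ++ e :: L₂) : N.arrivalTime z P (N.tail e) = N.traverse z L₁ := by
  ext θ
  unfold arrivalTime traverse
  have hw := P.isWalk
  have hn := P.nodup
  rw [h] at hw hn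
  obtain ⟨m, hm, hm', -⟩ := (isWalk_append _ _).1 hw
  have hL : ∀ e' ∈ L₁, N.tail e' ≠ N.tail e := by
    rw [hm']
    refine hm.tail_ne (hn.sublist ?_)
    simp
  rw [h, List.takeWhile_append_of_pos (by simpa using hL), List.takeWhile_cons_of_neg (by simp),
    List.append_nil]

theorem STPath.edges_ne_nil (P : N.STPath) : P.edges ≠ [] := by
  intro h
  have := P.isWalk
  rw [h] at this
  exact N.source_ne_sink this

end Walk

end FlowNetwork

/-! ### Paths as bottleneck queues; throughput of arbitrary and of Nash flows -/

namespace FlowNetwork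

open MeasureTheory Set

/-- By continuity and monotonicity the departures arriving before `T` form `[0, κ)`. The clause `κ =
0` covers the case in which even the first particle is late. -/
theorem IsTimeMap.exists_first {φ : ℝ → ℝ} (h : IsTimeMap φ) (T : ℝ) :
    ∃ κ, 0 ≤ κ ∧ T ≤ φ κ ∧ (κ = 0 ∨ φ κ ≤ T) ∧ ∀ x, 0 ≤ x → (φ x < T ↔ x < κ) := by
  have hcl : IsClosed (Icc 0 (max T 0) ∩ φ ⁻¹' Ici T) :=
    (h.continuousOn.mono Icc_subset_Ici_self).preimage_isClosed_of_isClosed isClosed_Icc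
      isClosed_Ici
  have hcp := isCompact_Icc.of_isClosed_subset hcl inter_subset_left
  obtain ⟨κ, ⟨⟨hκ0, hκT⟩, hκ⟩, hmin⟩ := hcp.exists_isLeast
    ⟨max T 0, ⟨le_max_right _ _, le_rfl⟩,
      (le_max_left T 0).trans (h.le_apply _ (le_max_right _ _))⟩
  have hlt : ∀ x, 0 ≤ x → x < κ → φ x < T := by
    intro x hx hxκ
    by_contra! hT
    exact absurd (hmin ⟨⟨hx, hxκ.le.trans hκT⟩, hT⟩) (not_le.2 hxκ)
  refine ⟨κ, hκ0, hκ, ?_, fun x hx => ⟨fun hxT => ?_, hlt x hx⟩⟩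
  · rcases hκ0.eq_or_lt with h0 | h0
    · exact Or.inl h0.symm
    · right
      obtain ⟨x, hx, hxT⟩ := intermediate_value_Icc hκ0
        (h.continuousOn.mono Icc_subset_Ici_self) ⟨(hlt 0 le_rfl h0).le, hκ⟩
      rcases hx.2.eq_or_lt with rfl | hlt'
      · exact hxT.le
      · exact absurd hxT (hlt x hx.1 hlt').ne
  · by_contra! hκx
    exact absurd hxT (not_lt.2 (hκ.trans (h.monotoneOn hκ0 hx hκx)))

variable {V E : Type*} [Finite E] {N : FlowNetwork V E}

/-- The bottleneck capacity of a path. -/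
noncomputable def STPath.capacity (P : N.STPath) : ℝ :=
  ⨅ e : {e // e ∈ P.edges}, N.capacity e

theorem STPath.capacity_le (P : N.STPath) {e : E} (he : e ∈ P.edges) :
    P.capacity ≤ N.capacity e :=
  ciInf_le (f := fun e : {e // e ∈ P.edges} => N.capacity e) (Set.finite_range _).bddBelow ⟨e, he⟩

theorem STPath.exists_capacity_eq (P : N.STPath) : ∃ e ∈ P.edges, N.capacity e = P.capacity := by
  obtain ⟨e, he⟩ := List.exists_mem_of_ne_nil _ P.edges_ne_nil
  have : Nonempty {e // e ∈ P.edges} := ⟨⟨e, he⟩⟩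
  obtain ⟨e', he'⟩ := exists_eq_ciInf_of_finite (f := fun e : {e // e ∈ P.edges} => N.capacity e)
  exact ⟨e', e'.2, he'⟩

theorem STPath.capacity_pos (P : N.STPath) : 0 < P.capacity := by
  obtain ⟨e, -, he⟩ := P.exists_capacity_eq
  exact he ▸ N.capacity_pos e

omit [Finite E] in
theorem STPath.transitTime_nonneg (P : N.STPath) : 0 ≤ P.transitTime :=
  List.sum_nonneg (by simpa using fun e _ => N.transitTime_nonneg e)

namespace FlowOverTime

variable (f : N.FlowOverTime)

/-- The amount of flow sent into a path up to a given time. -/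
noncomputable def cumInflow (P : N.STPath) (θ : ℝ) : ℝ := ∫ x in (0 : ℝ)..θ, f.pathInflow P x

theorem pathInflow_le (P : N.STPath) {θ : ℝ} (hθ : 0 ≤ θ) : f.pathInflow P θ ≤ N.inflowRate := by
  rw [← f.sum_pathInflow θ hθ]
  exact Finset.single_le_sum (fun Q _ => f.pathInflow_nonneg Q θ hθ) (Finset.mem_univ P)

theorem pathInflow_intervalIntegrable (P : N.STPath) {θ : ℝ} (hθ : 0 ≤ θ) :
    IntervalIntegrable (f.pathInflow P) volume 0 θ := by
  refine (intervalIntegrable_const (c := N.inflowRate)).mono_fun'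
    (f.pathInflow_measurable P).aestronglyMeasurable ?_
  rw [uIoc_of_le hθ]
  filter_upwards [ae_restrict_mem measurableSet_Ioc] with x hx
  rw [Real.norm_of_nonneg (f.pathInflow_nonneg P x hx.1.le)]
  exact f.pathInflow_le P hx.1.le

theorem cumInflow_monotoneOn (P : N.STPath) : MonotoneOn (f.cumInflow P) (Ici 0) :=
  monotoneOn_integral (f.pathInflow_nonneg P) fun _ => f.pathInflow_intervalIntegrable P

theorem sum_cumInflow {θ : ℝ} (hθ : 0 ≤ θ) : ∑ P, f.cumInflow P θ = N.inflowRate * θ := by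
  unfold cumInflow
  rw [← intervalIntegral.integral_finsetSum fun P _ => f.pathInflow_intervalIntegrable P hθ,
    intervalIntegral.integral_of_le hθ, setIntegral_congr_fun measurableSet_Ioc
      (g := fun _ => N.inflowRate) fun x hx => f.sum_pathInflow x hx.1.le,
    ← intervalIntegral.integral_of_le hθ]
  simp [mul_comm]

theorem cumInflow_eq_zero {P : N.STPath} {θ : ℝ} (hθ : 0 ≤ θ)
    (h : ∀ x, 0 < x → x < θ → f.pathInflow P x = 0) : f.cumInflow P θ = 0 := by
  unfold cumInflow
  rw [intervalIntegral.integral_of_le hθ, integral_Ioc_eq_integral_Ioo,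
    setIntegral_congr_fun measurableSet_Ioo (g := fun _ => 0) fun x hx => h x hx.1 hx.2]
  simp

variable (hN : N.IsParallelPathNetwork)

include hN in
theorem isLoaded (P : N.STPath) :
    N.IsLoaded f.edgeInflow f.queue P.edges (f.pathInflow P) := by
  classical
  intro L₁ e L₂ hL
  refine ⟨f.edgeInflow_nonneg e, f.edgeInflow_integrable e, f.isQueue e, fun θ hθ => ?_⟩
  have heP : e ∈ P.edges := by simp [hL]
  rw [f.integral_edgeInflow e θ hθ, Finset.sum_eq_single P, arrivalTime_tail _ P hL]
  · intro Q hQ hQP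
    exact absurd heP (fun h => hN Q P hQP (Finset.mem_filter.1 hQ).2 h)
  · intro h
    exact absurd (Finset.mem_filter.2 ⟨Finset.mem_univ P, heP⟩) h

include hN in
theorem travelBounds (P : N.STPath) :
    N.TravelBounds P.edges (f.pathInflow P) (f.sinkArrival P) := by
  have := (f.isLoaded hN P).travelBounds (f.pathInflow_nonneg P)
    (fun _ => f.pathInflow_intervalIntegrable P)
  rwa [← arrivalTime_sink] at this

include hN in
theorem isTimeMap_sinkArrival (P : N.STPath) : IsTimeMap (f.sinkArrival P) :=
  (f.travelBounds hN P).isTimeMap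

include hN in
theorem le_sinkArrival (P : N.STPath) {s θ : ℝ} (hs : 0 ≤ s) (hsθ : s ≤ θ) :
    P.transitTime + s + (f.cumInflow P θ - f.cumInflow P s) / P.capacity ≤ f.sinkArrival P θ := by
  obtain ⟨e, he, heq⟩ := P.exists_capacity_eq
  rw [← heq]
  exact (f.travelBounds hN P).lower e he s θ hs hsθ

include hN in
theorem exists_sinkArrival_le (P : N.STPath) {θ : ℝ} (hθ : 0 ≤ θ) : ∃ s, 0 ≤ s ∧ s ≤ θ ∧
    f.sinkArrival P θ ≤
      P.transitTime + s + (f.cumInflow P θ - f.cumInflow P s) / P.capacity :=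
  (f.travelBounds hN P).upper _ P.capacity_pos (fun _ he => P.capacity_le he) θ hθ

theorem setIntegral_of_iff {P : N.STPath} {T κ : ℝ} (hκ : 0 ≤ κ)
    (h : ∀ x, 0 ≤ x → (f.sinkArrival P x < T ↔ x < κ)) :
    ∫ ξ in {ξ : ℝ | 0 ≤ ξ ∧ f.sinkArrival P ξ < T}, f.pathInflow P ξ = f.cumInflow P κ := by
  have : {ξ : ℝ | 0 ≤ ξ ∧ f.sinkArrival P ξ < T} = Ico 0 κ := by
    ext x
    exact and_congr_right fun hx => h x hx
  rw [this, integral_Ico_eq_integral_Ioo, ← integral_Ioc_eq_integral_Ioo, cumInflow,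
    intervalIntegral.integral_of_le hκ]

-- Split each path's flow at time `t`. Together the paths receive `u * t` before `t`; what enters
-- later and still arrives before `T` passes the bottleneck within `T - τ_P - t`. Varying `t` gives
-- dual bounds for the optimum.
include hN in
theorem throughput_le (T : ℝ) {t : ℝ} (ht : 0 ≤ t) :
    f.throughput T ≤
      N.inflowRate * t + ∑ P : N.STPath, P.capacity * max (T - P.transitTime - t) 0 := by
  unfold throughput
  rw [← f.sum_cumInflow ht, ← Finset.sum_add_distrib]
  refine Finset.sum_le_sum fun P _ => ?_
  obtain ⟨κ, hκ0, -, hκ, hiff⟩ := (f.isTimeMap_sinkArrival hN P).exists_first T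
  rw [f.setIntegral_of_iff hκ0 hiff]
  have hc := P.capacity_pos
  rcases le_or_gt κ t with hκt | htκ
  · have h1 := f.cumInflow_monotoneOn P hκ0 ht hκt
    have h2 : 0 ≤ P.capacity * max (T - P.transitTime - t) 0 := by positivity
    linarith
  · have h1 := f.le_sinkArrival hN P ht htκ.le
    have h2 : f.sinkArrival P κ ≤ T := hκ.resolve_left (ht.trans_lt htκ).ne'
    have h3 : (f.cumInflow P κ - f.cumInflow P t) / P.capacity ≤
        max (T - P.transitTime - t) 0 := le_max_of_le_left (by linarith)
    rw [div_le_iff₀ hc] at h3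
    linarith

/-- No path allows an arrival before the deadline when leaving at time `θ`. -/
def AllMiss (θ : ℝ) : Prop := ∀ P : N.STPath, N.deadline ≤ f.sinkArrival P θ

-- While some path is on time, a Nash flow never enters a late one. Hence all flow departing before
-- `Θ` counts, and none departing later does.
include hN in
theorem IsNash.throughput_eq {f : N.FlowOverTime} (hf : f.IsNash) {Θ : ℝ} (hΘ0 : 0 ≤ Θ)
    (hΘ : f.AllMiss Θ) (halive : ∀ θ, 0 ≤ θ → θ < Θ → ¬ f.AllMiss θ) :
    f.throughput N.deadline = N.inflowRate * Θ := by
  unfold throughput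
  rw [← f.sum_cumInflow hΘ0]
  refine Finset.sum_congr rfl fun P _ => ?_
  obtain ⟨κ, hκ0, hκ, -, hiff⟩ := (f.isTimeMap_sinkArrival hN P).exists_first N.deadline
  rw [f.setIntegral_of_iff hκ0 hiff]
  have hκΘ : κ ≤ Θ := by
    by_contra! h
    exact absurd ((hiff Θ hΘ0).2 h) (not_lt.2 (hΘ P))
  have h0 : ∫ x in κ..Θ, f.pathInflow P x = 0 := by
    rw [intervalIntegral.integral_of_le hκΘ, integral_Ioc_eq_integral_Ioo,
      setIntegral_congr_fun measurableSet_Ioo (g := fun _ => 0)]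
    · simp
    · intro x hx
      have hx0 := hκ0.trans hx.1.le
      by_contra hne
      have hpos := lt_of_le_of_ne (f.pathInflow_nonneg P x hx0) (Ne.symm hne)
      obtain ⟨Q, hQ⟩ := not_forall.1 (halive x hx0 hx.2)
      have h1 := hf x hx0 P hpos Q
      have h2 : ¬ f.sinkArrival P x < N.deadline := fun h =>
        absurd ((hiff x hx0).1 h) (not_lt.2 hx.1.le)
      simp only [particleCost, if_neg h2, if_pos (not_le.1 hQ), top_le_iff] at h1
      exact WithTop.coe_ne_top h1
  have := intervalIntegral.integral_interval_sub_left (f.pathInflow_intervalIntegrable P hΘ0)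
    (f.pathInflow_intervalIntegrable P hκ0)
  rw [h0] at this
  unfold cumInflow
  linarith

end FlowOverTime

end FlowNetwork

/-! ### Using up paths one after the other: lower bound for Nash flows -/

namespace FlowNetwork

open MeasureTheory Set

variable {V E : Type*} [Finite E] {N : FlowNetwork V E}

/-- The latest time by which an undelayed particle can leave the source. -/
noncomputable def STPath.slack (P : N.STPath) : ℝ := N.deadline - P.transitTime

/-- The share of the network inflow that a path lets through. -/
noncomputable def STPath.share (P : N.STPath) : ℝ := min 1 (P.capacity / N.inflowRate)

theorem STPath.share_pos (P : N.STPath) : 0 < P.share :=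
  lt_min one_pos (div_pos P.capacity_pos N.inflowRate_pos)

omit [Finite E] in
theorem STPath.share_le_one (P : N.STPath) : P.share ≤ 1 := min_le_left _ _

omit [Finite E] in
theorem STPath.inflowRate_mul_share_le (P : N.STPath) : N.inflowRate * P.share ≤ P.capacity := by
  have h := min_le_right 1 (P.capacity / N.inflowRate)
  rwa [le_div_iff₀ N.inflowRate_pos, mul_comm] at h

omit [Finite E] in
theorem STPath.slack_le (P : N.STPath) : P.slack ≤ N.deadline :=
  sub_le_self _ P.transitTime_nonneg

/-- The time at which a path becomes useless that receives the whole network inflow from time `t`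
on. -/
noncomputable def STPath.useUp (P : N.STPath) (t : ℝ) : ℝ := t + P.share * max (P.slack - t) 0

theorem STPath.le_useUp (P : N.STPath) (t : ℝ) : t ≤ P.useUp t :=
  le_add_of_nonneg_right (mul_nonneg P.share_pos.le (le_max_right _ _))

/-- A later start shortens the filling time at rate at most `share ≤ 1`, so the finish is never
earlier. -/
theorem STPath.useUp_mono (P : N.STPath) : Monotone P.useUp := by
  intro s t hst
  have h1 : max (P.slack - s) 0 ≤ max (P.slack - t) 0 + (t - s) := by
    apply max_le
    · linarith [le_max_left (P.slack - t) 0]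
    · linarith [le_max_right (P.slack - t) 0]
  have h2 := mul_le_mul_of_nonneg_left h1 P.share_pos.le
  have h3 := mul_le_mul_of_nonneg_right P.share_le_one (sub_nonneg.2 hst)
  unfold STPath.useUp
  linarith

omit [Finite E] in
theorem STPath.useUp_le (P : N.STPath) {t B : ℝ} (ht : t ≤ B) (hd : P.slack ≤ B) :
    P.useUp t ≤ B := by
  have h1 : max (P.slack - t) 0 ≤ B - t := max_le (by linarith) (by linarith)
  have h2 := mul_le_mul P.share_le_one h1 (le_max_right _ _) zero_le_one
  unfold STPath.useUp
  linarith

/-- The time until which some path of a list is useful if its paths are used up one after the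
other, starting at the end of the list. -/
noncomputable def seqUseUp : List N.STPath → ℝ
  | [] => 0
  | P :: l => P.useUp (seqUseUp l)

theorem seqUseUp_nonneg (l : List N.STPath) : 0 ≤ seqUseUp l := by
  induction l with
  | nil => exact le_rfl
  | cons P l ih => exact ih.trans (P.le_useUp _)

omit [Finite E] in
theorem seqUseUp_le (hD : 0 ≤ N.deadline) (l : List N.STPath) : seqUseUp l ≤ N.deadline := by
  induction l with
  | nil => exact hD
  | cons P l ih => exact P.useUp_le ih P.slack_le

theorem seqUseUp_pos {l : List N.STPath} {P : N.STPath} (hP : P ∈ l) (hslack : 0 < P.slack) :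
    0 < seqUseUp l := by
  induction l with
  | nil => simp at hP
  | cons Q l ih =>
    rcases List.mem_cons.1 hP with rfl | hP
    · rcases (seqUseUp_nonneg l).eq_or_lt with h | h
      · have h1 := mul_pos P.share_pos (lt_max_of_lt_left (c := (0 : ℝ)) hslack)
        simpa [seqUseUp, ← h, STPath.useUp] using h1
      · exact h.trans_le (P.le_useUp _)
    · exact (ih hP).trans_le (Q.le_useUp _)

/-- Inflow totals that use up the paths of a list after times `s` need at least as much time as
using up the paths one after the other, in the order of these times. -/
theorem seqUseUp_le_of_budget {F : N.STPath → ℝ → ℝ} {Y s : N.STPath → ℝ}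
    (hF : ∀ P, MonotoneOn (F P) (Ici 0)) (hs : ∀ P, 0 ≤ s P) (hY : ∀ P Q, F P (s Q) ≤ Y P)
    (hfill : ∀ P : N.STPath,
      N.inflowRate * (P.share * max (P.slack - s P) 0) ≤ Y P - F P (s P))
    (l : List N.STPath) (hl : l.Pairwise fun P Q => s Q ≤ s P) {b : ℝ} (hb : 0 ≤ b)
    (hbudget : ∀ Q ∈ l, (l.map fun P => Y P - F P (s Q)).sum ≤ N.inflowRate * (b - s Q)) :
    seqUseUp l ≤ b := by
  induction l generalizing b with
  | nil => exact hb
  | cons P l ih =>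
    have hu := N.inflowRate_pos
    have hsort := List.pairwise_cons.1 hl
    set w := P.share * max (P.slack - s P) 0 with hw
    -- `P` heads the list, so its time `s P` is the latest. Its required inflow `w` therefore lies
    -- after every `s Q` and can be deducted from every remaining budget.
    have hstep : ∀ Q, s Q ≤ s P →
        (((P :: l).map fun R => Y R - F R (s Q)).sum ≤ N.inflowRate * (b - s Q)) →
        (l.map fun R => Y R - F R (s Q)).sum ≤ N.inflowRate * (b - w - s Q) := by
      intro Q hQ h
      simp only [List.map_cons, List.sum_cons] at h
      have h1 := hF P (hs Q) (hs P) hQ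
      have h2 := hfill P
      rw [← hw] at h2
      linarith
    have hsP : s P ≤ b - w := by
      have h1 := hstep P le_rfl (hbudget P (by simp))
      have h2 : 0 ≤ (l.map fun R => Y R - F R (s P)).sum :=
        List.sum_nonneg (by simpa using fun R _ => hY R P)
      have := nonneg_of_mul_nonneg_right (h2.trans h1) hu
      linarith
    have h1 : seqUseUp l ≤ b - w :=
      ih hsort.2 ((hs P).trans hsP) fun Q hQ =>
        hstep Q (hsort.1 Q hQ) (hbudget Q (List.mem_cons_of_mem _ hQ))
    -- As `s P ≤ b - w`, starting `P` at `b - w` instead of `s P` needs no more than `w`, so it is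
    -- finished by `b`.
    have h2 : P.share * max (P.slack - (b - w)) 0 ≤ w := by
      rw [hw]
      exact mul_le_mul_of_nonneg_left (max_le_max (by rw [← hw]; linarith) le_rfl) P.share_pos.le
    have h3 := P.useUp_mono h1
    have h4 : P.useUp (b - w) ≤ b := by
      unfold STPath.useUp
      linarith
    exact h3.trans h4

/-- The list contains every path once, and the more expensive ones come first. -/
structure IsCostOrder (l : List N.STPath) : Prop where
  nodup : l.Nodup
  mem : ∀ P, P ∈ l
  pairwise : l.Pairwise fun P Q => Q.cost ≤ P.cost

theorem IsCostOrder.sum_map {l : List N.STPath} (h : IsCostOrder l) (g : N.STPath → ℝ) :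
    (l.map g).sum = ∑ P, g P := by
  classical
  rw [← List.sum_toFinset g h.nodup]
  congr 1
  ext P
  simp [h.mem P]

/-- Sort lexicographically by `s`, then by cost. Since `s` is weakly increasing in cost, breaking
its ties by cost satisfies both orders. -/
theorem exists_isCostOrder (s : N.STPath → ℝ)
    (hs : ∀ P Q : N.STPath, P.cost < Q.cost → s P ≤ s Q) :
    ∃ l : List N.STPath, IsCostOrder l ∧ l.Pairwise fun P Q => s Q ≤ s P := by
  classical
  let r : N.STPath → N.STPath → Prop := fun P Q => toLex (s Q, Q.cost) ≤ toLex (s P, P.cost)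
  have : Std.Total r := ⟨fun P Q => le_total _ _⟩
  have : IsTrans N.STPath r := ⟨fun P Q R h1 h2 => h2.trans h1⟩
  have hp := List.pairwise_insertionSort r Finset.univ.toList
  refine ⟨List.insertionSort r Finset.univ.toList, ⟨?_, ?_, ?_⟩, ?_⟩
  · exact (List.perm_insertionSort r _).nodup_iff.2 (Finset.nodup_toList _)
  · intro P
    simp
  · refine hp.imp fun {P Q} h => ?_
    by_contra! hlt
    rcases Prod.Lex.toLex_le_toLex.1 h with h | h
    · exact absurd (hs P Q hlt) (not_le.2 h)
    · exact absurd hlt (not_lt.2 h.2)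
  · refine hp.imp fun {P Q} h => ?_
    rcases Prod.Lex.toLex_le_toLex.1 h with h | h
    · exact h.le
    · exact h.1.le

theorem finite_setOf_isCostOrder : {l : List N.STPath | IsCostOrder l}.Finite := by
  classical
  refine (Set.toFinite (Set.range fun l : {l : List N.STPath // l.Nodup} => l.1)).subset ?_
  rintro l hl
  exact ⟨⟨l, hl.nodup⟩, rfl⟩

theorem exists_isCostOrder_minimal :
    ∃ l : List N.STPath, IsCostOrder l ∧
      ∀ l' : List N.STPath, IsCostOrder l' → seqUseUp l ≤ seqUseUp l' := by
  obtain ⟨l₀, hl₀, -⟩ := exists_isCostOrder (N := N) (fun _ => 0) fun _ _ _ => le_rfl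
  exact Set.exists_min_image _ seqUseUp finite_setOf_isCostOrder ⟨l₀, hl₀⟩

/-- Each path must have received enough flow to miss the deadline. Charging that flow after suitable
times compatible with the costs gives a budget for `seqUseUp_le_of_budget`. -/
theorem FlowOverTime.IsNash.exists_isCostOrder_le (hN : N.IsParallelPathNetwork)
    {f : N.FlowOverTime} (hf : f.IsNash) [Nonempty N.STPath] :
    ∃ l : List N.STPath, IsCostOrder l ∧
      N.inflowRate * seqUseUp l ≤ f.throughput N.deadline := by
  classical
  choose κ hκ0 hκ _ hiff using fun P => (f.isTimeMap_sinkArrival hN P).exists_first N.deadline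
  choose s hs0 hsκ hs using fun P => f.exists_sinkArrival_le hN P (hκ0 P)
  obtain ⟨P₁, hP₁⟩ := Finite.exists_max κ
  set Θ := κ P₁ with hΘ
  have hΘ0 : 0 ≤ Θ := hκ0 P₁
  have hthr : f.throughput N.deadline = N.inflowRate * Θ := by
    refine hf.throughput_eq hN hΘ0 (fun P => ?_) fun θ hθ hlt h => ?_
    · exact (hκ P).trans ((f.isTimeMap_sinkArrival hN P).monotoneOn (hκ0 P) hΘ0 (hP₁ P))
    · exact absurd ((hiff P₁ θ hθ).2 hlt) (not_lt.2 (h P₁))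
  -- Until `a P` some cheaper path is on time, so `P` is unused. For a cheapest path the supremum is
  -- over the empty type and equals `0`.
  set a : N.STPath → ℝ := fun P => ⨆ Q : {Q : N.STPath // Q.cost < P.cost}, κ Q with ha
  have ha0 : ∀ P, 0 ≤ a P := fun P => Real.iSup_nonneg fun Q => hκ0 Q
  have hκa : ∀ P Q : N.STPath, Q.cost < P.cost → κ Q ≤ a P := fun P Q h =>
    le_ciSup (f := fun Q : {Q : N.STPath // Q.cost < P.cost} => κ Q)
      (Set.finite_range _).bddAbove ⟨Q, h⟩
  have haΘ : ∀ P, a P ≤ Θ := fun P => Real.iSup_le (fun Q => hP₁ Q) hΘ0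
  have haa : ∀ P Q : N.STPath, Q.cost < P.cost → a Q ≤ a P := fun P Q h =>
    Real.iSup_le (fun R => hκa P R (R.2.trans h)) (ha0 P)
  have hzero : ∀ P, f.cumInflow P (a P) = 0 := by
    intro P
    refine f.cumInflow_eq_zero (ha0 P) fun x hx hxa => ?_
    by_contra hne
    have hpos := lt_of_le_of_ne (f.pathInflow_nonneg P x hx.le) (Ne.symm hne)
    obtain ⟨Q, hQ⟩ : ∃ Q : {Q : N.STPath // Q.cost < P.cost}, x < κ Q := by
      by_contra! h
      exact absurd (Real.iSup_le h hx.le) (not_le.2 hxa)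
    have h1 := hf x hx.le P hpos Q
    have h2 : (Q : N.STPath).cost < P.cost := Q.2
    unfold FlowOverTime.particleCost at h1
    rw [if_pos ((hiff Q x hx.le).2 hQ)] at h1
    split_ifs at h1
    · exact absurd (WithTop.coe_le_coe.1 h1) (not_le.2 h2)
    · simp at h1
  -- `s P` is the departure time witnessing the bound for the arrival of particle `κ P`. Moving it
  -- up to `a P` skips no inflow, and makes the times monotone in cost because `s P ≤ κ P ≤ a Q` for
  -- dearer `Q`.
  set s' : N.STPath → ℝ := fun P => max (s P) (a P) with hs'
  have hs'0 : ∀ P, 0 ≤ s' P := fun P => le_max_of_le_left (hs0 P)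
  have hs'Θ : ∀ P, s' P ≤ Θ := fun P => max_le ((hsκ P).trans (hP₁ P)) (haΘ P)
  have hmono : ∀ P, MonotoneOn (f.cumInflow P) (Ici 0) := f.cumInflow_monotoneOn
  have hfill : ∀ P : N.STPath, N.inflowRate * (P.share * max (P.slack - s' P) 0) ≤
      f.cumInflow P Θ - f.cumInflow P (s' P) := by
    intro P
    have h0 : f.cumInflow P (s' P) ≤ f.cumInflow P Θ := hmono P (hs'0 P) hΘ0 (hs'Θ P)
    rcases le_total (P.slack - s' P) 0 with hneg | hpos
    · rw [max_eq_right hneg]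
      simpa using h0
    rw [max_eq_left hpos, ← mul_assoc]
    have h1 := mul_le_mul_of_nonneg_right P.inflowRate_mul_share_le hpos
    refine h1.trans ?_
    have h2 : P.slack - s P ≤ (f.cumInflow P (κ P) - f.cumInflow P (s P)) / P.capacity := by
      have := (hκ P).trans (hs P)
      unfold STPath.slack
      linarith
    rw [le_div_iff₀ P.capacity_pos] at h2
    have h3 : f.cumInflow P (κ P) ≤ f.cumInflow P Θ := hmono P (hκ0 P) hΘ0 (hP₁ P)
    have h4 : P.capacity * (P.slack - s' P) ≤ P.capacity * (P.slack - s P) :=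
      mul_le_mul_of_nonneg_left (sub_le_sub_left (le_max_left _ _) _) P.capacity_pos.le
    have h5 : f.cumInflow P (s' P) ≤ f.cumInflow P (s P) := by
      rcases le_total (a P) (s P) with h | h
      · rw [hs']
        simp only [max_eq_left h, le_refl]
      · rw [hs']
        simp only [max_eq_right h, hzero P]
        have := hmono P self_mem_Ici (hs0 P) (hs0 P)
        simpa [FlowOverTime.cumInflow] using this
    linarith
  obtain ⟨l, hl, hsort⟩ := exists_isCostOrder s' fun P Q hPQ =>
    (max_le ((hsκ P).trans (hκa Q P hPQ)) (haa Q P hPQ)).trans (le_max_right _ _)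
  refine ⟨l, hl, ?_⟩
  rw [hthr]
  refine mul_le_mul_of_nonneg_left ?_ N.inflowRate_pos.le
  refine seqUseUp_le_of_budget (F := f.cumInflow) (Y := fun P => f.cumInflow P Θ) (s := s')
    hmono hs'0 (fun P Q => hmono P (hs'0 Q) hΘ0 (hs'Θ Q)) hfill l hsort hΘ0 fun Q _ => ?_
  rw [hl.sum_map, Finset.sum_sub_distrib, f.sum_cumInflow hΘ0, f.sum_cumInflow (hs'0 Q)]
  exact (mul_sub _ _ _).ge

end FlowNetwork

/-! ### Existence of flows with piecewise constant path inflow -/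

namespace FlowNetwork

open MeasureTheory Set Filter Topology

/-- Right derivatives suffice for the fundamental theorem of calculus; this is why inflow periods
are closed on the left and open on the right. -/
theorem isQueue_of_hasDerivWithinAt {ν : ℝ} {f z : ℝ → ℝ} (hz : Continuous z) (h0 : z 0 = 0)
    (hf : ∀ θ, 0 ≤ θ → IntervalIntegrable f volume 0 θ)
    (hd : ∀ x, 0 ≤ x → HasDerivWithinAt z (queueRate ν f z x) (Ioi x) x) : IsQueue ν f z := by
  refine ⟨hz.continuousOn, fun θ hθ => ?_⟩
  change z θ = ∫ x in (0 : ℝ)..θ, queueRate ν f z x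
  rw [intervalIntegral.integral_eq_sub_of_hasDeriv_right_of_le hθ hz.continuousOn
    (fun x hx => hd x hx.1.le) (queueRate_intervalIntegrable hz.continuousOn hf le_rfl hθ), h0,
    sub_zero]

/-- A period of time, possibly unbounded, during which flow enters. -/
def IsPeriod (S : Set ℝ) : Prop :=
  ∃ α, 0 ≤ α ∧ (S = Ici α ∨ ∃ β, α ≤ β ∧ S = Ico α β)

theorem IsPeriod.measurableSet {S : Set ℝ} (h : IsPeriod S) : MeasurableSet S := by
  obtain ⟨α, -, rfl | ⟨β, -, rfl⟩⟩ := h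
  · exact measurableSet_Ici
  · exact measurableSet_Ico

theorem indicator_intervalIntegrable {S : Set ℝ} (hS : MeasurableSet S) (r a b : ℝ) :
    IntervalIntegrable (S.indicator fun _ => r) volume a b := by
  rw [intervalIntegrable_iff]
  exact (intervalIntegrable_const (c := r)).def'.indicator hS

theorem integral_indicator_eq {S : Set ℝ} (hS : MeasurableSet S) (r : ℝ) {t : ℝ} (ht : 0 ≤ t) :
    ∫ x in (0 : ℝ)..t, S.indicator (fun _ => r) x = volume.real (Icc 0 t ∩ S) * r := by
  rw [← setIntegral_Icc_zero ht, setIntegral_indicator hS, setIntegral_const, smul_eq_mul]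

theorem volume_Ico_inter_Iic (a b c : ℝ) :
    volume.real (Ico a b ∩ Iic c) = max (min b c - a) 0 := by
  apply le_antisymm
  · rw [← Real.volume_real_Icc]
    exact measureReal_mono (fun x hx => ⟨hx.1.1, le_min hx.1.2.le hx.2⟩) (by simp)
  · rw [← Real.volume_real_Ico]
    refine measureReal_mono (fun x hx => ⟨⟨hx.1, hx.2.trans_le (min_le_left _ _)⟩,
      (hx.2.trans_le (min_le_right _ _)).le⟩) ?_
    exact ((measure_mono inter_subset_left).trans_lt (by simp)).ne

section SingleEdge

variable {ν τ r α : ℝ}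

theorem queue_slope_pos (hν : 0 < ν) : 0 < 1 + max (r - ν) 0 / ν := by positivity

theorem isQueue_Ici (hν : 0 < ν) (hα : 0 ≤ α) :
    IsQueue ν ((Ici α).indicator fun _ => r) fun x => max (r - ν) 0 * max (x - α) 0 := by
  refine isQueue_of_hasDerivWithinAt (by fun_prop) ?_
    (fun θ _ => indicator_intervalIntegrable measurableSet_Ici r 0 θ) fun x hx => ?_
  · rw [max_eq_right (by linarith : 0 - α ≤ 0), mul_zero]
  rcases lt_or_ge x α with hxα | hαx
  · have hz : max (x - α) 0 = 0 := max_eq_right (by linarith)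
    have hr : queueRate ν ((Ici α).indicator fun _ => r)
        (fun x => max (r - ν) 0 * max (x - α) 0) x = 0 := by
      simp [queueRate, hz, indicator_of_notMem (show x ∉ Ici α from not_le.2 hxα), hν.le]
    rw [hr]
    refine (hasDerivWithinAt_const x _ (0 : ℝ)).congr_of_eventuallyEq ?_ (by simp [hz])
    filter_upwards [mem_nhdsWithin_of_mem_nhds (Iio_mem_nhds hxα)] with y hy
    rw [max_eq_right (by linarith [mem_Iio.1 hy] : y - α ≤ 0), mul_zero]
  · have hr : queueRate ν ((Ici α).indicator fun _ => r)
        (fun x => max (r - ν) 0 * max (x - α) 0) x = max (r - ν) 0 := by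
      simp only [queueRate, indicator_of_mem (show x ∈ Ici α from hαx)]
      split_ifs with h
      · rw [max_eq_left]
        by_contra! hneg
        rw [max_eq_right hneg.le, zero_mul] at h
        exact lt_irrefl _ h
      · rfl
    rw [hr]
    have hd : HasDerivWithinAt (fun x => max (r - ν) 0 * (x - α)) (max (r - ν) 0) (Ioi x) x := by
      simpa using (((hasDerivAt_id x).sub_const α).const_mul (max (r - ν) 0)).hasDerivWithinAt
    refine hd.congr (fun y hy => ?_) ?_
    · rw [max_eq_left (by linarith [mem_Ioi.1 hy] : 0 ≤ y - α)]
    · rw [max_eq_left (by linarith : 0 ≤ x - α)]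

/-- The queue grows at rate `max (r - ν) 0` until `β`, then drains at rate `ν` until empty: the
lower of two lines, cut off at `0`. -/
theorem isQueue_Ico {β : ℝ} (hν : 0 < ν) (hα : 0 ≤ α) :
    IsQueue ν ((Ico α β).indicator fun _ => r) fun x =>
      max (min (max (r - ν) 0 * (x - α)) (max (r - ν) 0 * (β - α) - ν * (x - β))) 0 := by
  set q := max (r - ν) 0 with hq
  have hq0 : 0 ≤ q := le_max_right _ _
  set z : ℝ → ℝ := fun x => max (min (q * (x - α)) (q * (β - α) - ν * (x - β))) 0 with hz
  have hbefore : ∀ x, x ≤ α → z x = 0 := fun x hx =>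
    max_eq_right (min_le_of_left_le (mul_nonpos_of_nonneg_of_nonpos hq0 (by linarith)))
  have hmid : ∀ x, α ≤ x → x ≤ β → z x = q * (x - α) := by
    intro x h1 h2
    have h3 : q * (x - α) ≤ q * (β - α) := by gcongr
    have h4 : ν * (x - β) ≤ 0 := mul_nonpos_of_nonneg_of_nonpos hν.le (by linarith)
    simp only [hz]
    rw [min_eq_left (by linarith), max_eq_left (mul_nonneg hq0 (by linarith))]
  have hafter : ∀ x, β ≤ x → z x = max (q * (β - α) - ν * (x - β)) 0 := by
    intro x h1
    have h3 : q * (β - α) ≤ q * (x - α) := by gcongr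
    have h4 : 0 ≤ ν * (x - β) := mul_nonneg hν.le (by linarith)
    simp only [hz]
    rw [min_eq_right (by linarith)]
  refine isQueue_of_hasDerivWithinAt (by fun_prop) (hbefore 0 hα)
    (fun θ _ => indicator_intervalIntegrable measurableSet_Ico r 0 θ) fun x hx => ?_
  rcases lt_or_ge x α with hxα | hαx
  · have hr : queueRate ν ((Ico α β).indicator fun _ => r) z x = 0 := by
      simp [queueRate, hbefore x hxα.le,
        indicator_of_notMem (show x ∉ Ico α β from fun h => not_le.2 hxα h.1), hν.le]
    rw [hr]
    refine (hasDerivWithinAt_const x _ (0 : ℝ)).congr_of_eventuallyEq ?_ (hbefore x hxα.le)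
    filter_upwards [mem_nhdsWithin_of_mem_nhds (Iio_mem_nhds hxα)] with y hy
    exact hbefore y (mem_Iio.1 hy).le
  rcases lt_or_ge x β with hxβ | hβx
  · have hr : queueRate ν ((Ico α β).indicator fun _ => r) z x = q := by
      simp only [queueRate, indicator_of_mem (show x ∈ Ico α β from ⟨hαx, hxβ⟩)]
      split_ifs with h
      · rw [hq, max_eq_left]
        by_contra! hneg
        rw [hmid x hαx hxβ.le, hq, max_eq_right hneg.le, zero_mul] at h
        exact lt_irrefl _ h
      · rfl
    rw [hr]
    have hd : HasDerivWithinAt (fun x => q * (x - α)) q (Ioi x) x := by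
      simpa using (((hasDerivAt_id x).sub_const α).const_mul q).hasDerivWithinAt
    refine hd.congr_of_eventuallyEq ?_ (hmid x hαx hxβ.le)
    filter_upwards [mem_nhdsWithin_of_mem_nhds (Iio_mem_nhds hxβ), self_mem_nhdsWithin] with y h1 h2
    exact hmid y (hαx.trans (mem_Ioi.1 h2).le) (mem_Iio.1 h1).le
  · have hind : (Ico α β).indicator (fun _ => r) x = 0 :=
      indicator_of_notMem (fun h => not_le.2 h.2 hβx) _
    rcases lt_or_ge 0 (q * (β - α) - ν * (x - β)) with hpos | hneg
    · have hzx : z x = q * (β - α) - ν * (x - β) := (hafter x hβx).trans (max_eq_left hpos.le)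
      have hr : queueRate ν ((Ico α β).indicator fun _ => r) z x = -ν := by
        simp [queueRate, hzx, hpos, hind]
      rw [hr]
      have hd : HasDerivWithinAt (fun x => q * (β - α) - ν * (x - β)) (-ν) (Ioi x) x := by
        simpa using ((((hasDerivAt_id x).sub_const β).const_mul ν).const_sub
          (q * (β - α))).hasDerivWithinAt
      refine hd.congr_of_eventuallyEq ?_ hzx
      have hc : Continuous fun x => q * (β - α) - ν * (x - β) := by fun_prop
      filter_upwards [mem_nhdsWithin_of_mem_nhds (hc.continuousAt.eventually (lt_mem_nhds hpos)),
        self_mem_nhdsWithin] with y h1 h2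
      exact (hafter y (hβx.trans (mem_Ioi.1 h2).le)).trans (max_eq_left (le_of_lt h1))
    · have hzero : ∀ y, x ≤ y → z y = 0 := by
        intro y hxy
        rw [hafter y (hβx.trans hxy), max_eq_right]
        have : ν * (x - β) ≤ ν * (y - β) := by gcongr
        linarith
      have hr : queueRate ν ((Ico α β).indicator fun _ => r) z x = 0 := by
        simp [queueRate, hzero x le_rfl, hind, hν.le]
      rw [hr]
      exact (hasDerivWithinAt_const x _ (0 : ℝ)).congr (fun y hy => hzero y (mem_Ioi.1 hy).le)
        (hzero x le_rfl)

theorem exit_le_iff (hν : 0 < ν) {x t : ℝ} :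
    x + max (r - ν) 0 * (x - α) / ν + τ ≤ t ↔
      x ≤ α + (t - (α + τ)) / (1 + max (r - ν) 0 / ν) := by
  have hκ := queue_slope_pos (r := r) hν
  rw [← sub_le_iff_le_add', le_div_iff₀ hκ]
  have : (x - α) * (1 + max (r - ν) 0 / ν) = (x - α) + max (r - ν) 0 * (x - α) / ν := by ring
  rw [this]
  constructor <;> intro h <;> linarith

/-- A constant inflow rate during some period yields a queue whose outflow rate is again constant
during some period. -/
theorem exists_isQueue_indicator (hν : 0 < ν) (hτ : 0 ≤ τ) (hr : 0 ≤ r) {S : Set ℝ}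
    (hS : IsPeriod S) :
    ∃ (z : ℝ → ℝ) (r' : ℝ) (S' : Set ℝ), 0 ≤ r' ∧ IsPeriod S' ∧
      IsQueue ν (S.indicator fun _ => r) z ∧ ∀ t, 0 ≤ t →
        ∫ x in (0 : ℝ)..t, S'.indicator (fun _ => r') x =
          ∫ ξ in {ξ : ℝ | 0 ≤ ξ ∧ ξ + z ξ / ν + τ ≤ t}, S.indicator (fun _ => r) ξ := by
  have hκ := queue_slope_pos (r := r) hν
  -- `κ` is the slope of the exit time during the inflow period. The outflow rate is thus `r / κ =
  -- min r ν`, and the period is stretched by `κ`.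
  set κ := 1 + max (r - ν) 0 / ν with hκdef
  obtain ⟨α, hα, rfl | ⟨β, hαβ, rfl⟩⟩ := hS
  · refine ⟨_, r / κ, Ici (α + τ), by positivity, ⟨α + τ, by positivity, Or.inl rfl⟩,
      isQueue_Ici hν hα, fun t ht => ?_⟩
    rw [integral_indicator_eq measurableSet_Ici _ ht, setIntegral_indicator measurableSet_Ici,
      setIntegral_const, smul_eq_mul]
    have h1 : Icc 0 t ∩ Ici (α + τ) = Icc (α + τ) t := by
      ext x
      simp only [mem_inter_iff, mem_Icc, mem_Ici]
      exact ⟨fun h => ⟨h.2, h.1.2⟩, fun h => ⟨⟨by linarith, h.2⟩, h.1⟩⟩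
    have h2 : {ξ : ℝ | 0 ≤ ξ ∧ ξ + max (r - ν) 0 * max (ξ - α) 0 / ν + τ ≤ t} ∩ Ici α =
        Icc α (α + (t - (α + τ)) / κ) := by
      ext x
      simp only [mem_inter_iff, mem_Icc, mem_Ici, mem_ofPred_eq]
      constructor
      · rintro ⟨⟨-, h⟩, hx⟩
        rw [max_eq_left (sub_nonneg.2 hx)] at h
        exact ⟨hx, (exit_le_iff hν).1 h⟩
      · rintro ⟨hx, h⟩
        rw [max_eq_left (sub_nonneg.2 hx)]
        exact ⟨⟨hα.trans hx, (exit_le_iff hν).2 h⟩, hx⟩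
    rw [h1, h2, Real.volume_real_Icc, Real.volume_real_Icc, add_sub_cancel_left,
      ← zero_div κ, max_div_div_right hκ.le, zero_div]
    ring
  · refine ⟨_, r / κ, Ico (α + τ) (α + τ + κ * (β - α)), by positivity,
      ⟨α + τ, by positivity, Or.inr ⟨_, ?_, rfl⟩⟩, isQueue_Ico hν hα, fun t ht => ?_⟩
    · have := mul_nonneg hκ.le (sub_nonneg.2 hαβ)
      linarith
    rw [integral_indicator_eq measurableSet_Ico _ ht, setIntegral_indicator measurableSet_Ico,
      setIntegral_const, smul_eq_mul]
    have h1 : Icc 0 t ∩ Ico (α + τ) (α + τ + κ * (β - α)) =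
        Ico (α + τ) (α + τ + κ * (β - α)) ∩ Iic t := by
      ext x
      simp only [mem_inter_iff, mem_Icc, mem_Ico, mem_Iic]
      exact ⟨fun h => ⟨h.2, h.1.2⟩, fun h => ⟨⟨by linarith [h.1.1], h.2⟩, h.1⟩⟩
    have hmid : ∀ x, α ≤ x → x < β → max (min (max (r - ν) 0 * (x - α))
        (max (r - ν) 0 * (β - α) - ν * (x - β))) 0 = max (r - ν) 0 * (x - α) := by
      intro x h1 h2
      have h3 : max (r - ν) 0 * (x - α) ≤ max (r - ν) 0 * (β - α) := by gcongr
      have h4 : ν * (x - β) ≤ 0 := mul_nonpos_of_nonneg_of_nonpos hν.le (by linarith)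
      rw [min_eq_left (by linarith), max_eq_left]
      exact mul_nonneg (le_max_right _ _) (sub_nonneg.2 h1)
    have h2 : {ξ : ℝ | 0 ≤ ξ ∧ ξ + max (min (max (r - ν) 0 * (ξ - α))
          (max (r - ν) 0 * (β - α) - ν * (ξ - β))) 0 / ν + τ ≤ t} ∩ Ico α β =
        Ico α β ∩ Iic (α + (t - (α + τ)) / κ) := by
      ext x
      simp only [mem_inter_iff, mem_Ico, mem_Iic, mem_ofPred_eq]
      constructor
      · rintro ⟨⟨-, h⟩, hx⟩
        rw [hmid x hx.1 hx.2] at h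
        exact ⟨hx, (exit_le_iff hν).1 h⟩
      · rintro ⟨hx, h⟩
        rw [hmid x hx.1 hx.2]
        exact ⟨⟨hα.trans hx.1, (exit_le_iff hν).2 h⟩, hx⟩
    have h3 : min (α + τ + κ * (β - α)) t - (α + τ) =
        κ * (min β (α + (t - (α + τ)) / κ) - α) := by
      rw [← min_sub_sub_right, ← min_sub_sub_right, add_sub_cancel_left, add_sub_cancel_left,
        mul_min_of_nonneg _ _ hκ.le, mul_div_cancel₀ _ hκ.ne']
    rw [h1, h2, volume_Ico_inter_Iic, volume_Ico_inter_Iic, h3, ← mul_zero κ,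
      ← mul_max_of_nonneg _ _ hκ.le, mul_zero]
    field_simp

end SingleEdge

variable {V E : Type*} {N : FlowNetwork V E}

theorem traverse_congr {z z' : E → ℝ → ℝ} {L : List E} (h : ∀ e ∈ L, z e = z' e) :
    N.traverse z L = N.traverse z' L := by
  ext θ
  refine List.foldl_ext _ _ _ fun t e he => ?_
  simp only [exitTime, h e he]

theorem IsLoaded.congr {inflow inflow' z z' : E → ℝ → ℝ} {L : List E} {f : ℝ → ℝ}
    (h : N.IsLoaded inflow z L f) (hi : ∀ e ∈ L, inflow e = inflow' e)
    (hz : ∀ e ∈ L, z e = z' e) : N.IsLoaded inflow' z' L f := by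
  intro L₁ e L₂ hL
  have he : e ∈ L := by simp [hL]
  rw [← hi e he, ← hz e he, ← traverse_congr fun e' he' => hz e' (by simp [hL, he'])]
  exact h L₁ e L₂ hL

/-- Outflow of the first edge is again constant on a period, so it can serve as the inflow of the
remaining edges. -/
theorem exists_isLoaded {L : List E} (hL : L.Nodup) {r : ℝ} (hr : 0 ≤ r) {S : Set ℝ}
    (hS : IsPeriod S) :
    ∃ inflow z : E → ℝ → ℝ, N.IsLoaded inflow z L (S.indicator fun _ => r) := by
  classical
  induction L generalizing r S with
  | nil => exact ⟨0, 0, fun L₁ e L₂ h => by simp at h⟩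
  | cons e L ih =>
    obtain ⟨heL, hL⟩ := List.nodup_cons.1 hL
    obtain ⟨z₀, r', S', hr', hS', hq, hout⟩ :=
      exists_isQueue_indicator (N.capacity_pos e) (N.transitTime_nonneg e) hr hS
    obtain ⟨inflow', z', h'⟩ := ih hL hr' hS'
    have hne : ∀ e' ∈ L, e' ≠ e := fun e' he' h => heL (h ▸ he')
    set inflow := Function.update inflow' e (S.indicator fun _ => r) with hi
    set z := Function.update z' e z₀ with hz
    have hie : inflow e = S.indicator fun _ => r := Function.update_self ..
    have hze : z e = z₀ := Function.update_self ..
    have hload : N.IsLoaded inflow z L (S'.indicator fun _ => r') :=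
      h'.congr (fun e' he' => (Function.update_of_ne (hne e' he') _ _).symm)
        fun e' he' => (Function.update_of_ne (hne e' he') _ _).symm
    refine ⟨inflow, z, fun L₁ e₁ L₂ h => ?_⟩
    rcases L₁ with _ | ⟨e₀, L₁⟩
    · obtain ⟨rfl, rfl⟩ := List.cons_eq_cons.1 h
      rw [hie, hze]
      refine ⟨fun θ _ => indicator_nonneg (fun _ _ => hr) θ,
        fun θ _ => indicator_intervalIntegrable hS.measurableSet r 0 θ, hq, fun θ hθ => ?_⟩
      exact (setIntegral_Icc_zero hθ).symm
    · obtain ⟨rfl, hL'⟩ := List.cons_eq_cons.1 h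
      obtain ⟨h1, h2, h3, h4⟩ := hload L₁ e₁ L₂ hL'
      refine ⟨h1, h2, h3, fun θ hθ => ?_⟩
      have hpre : N.IsLoaded inflow z L₁ (S'.indicator fun _ => r') := by
        rw [hL'] at hload
        exact hload.of_append
      have hφ := (hpre.travelBounds (fun θ _ => indicator_nonneg (fun _ _ => hr') θ)
        fun θ _ => indicator_intervalIntegrable hS'.measurableSet r' 0 θ).isTimeMap
      have hT : IsTimeMap fun ξ => ξ + z₀ ξ / N.capacity e + N.transitTime e :=
        hq.isTimeMap_exit (N.capacity_pos e) (N.transitTime_nonneg e)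
          (fun θ _ => indicator_nonneg (fun _ _ => hr) θ)
          fun θ _ => indicator_intervalIntegrable hS.measurableSet r 0 θ
      have htr : ∀ ξ, N.traverse z (e :: L₁) ξ =
          N.traverse z L₁ (ξ + z₀ ξ / N.capacity e + N.transitTime e) := by
        intro ξ
        rw [← hze]
        rfl
      simp only [htr]
      rw [h4 θ hθ]
      rcases hφ.setOf_le θ with hs | ⟨ρ, hρ0, -, hs⟩
      · rw [hs]
        have : {ξ : ℝ | 0 ≤ ξ ∧
            N.traverse z L₁ (ξ + z₀ ξ / N.capacity e + N.transitTime e) ≤ θ} = ∅ := by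
          refine eq_empty_of_forall_notMem fun ξ hξ => ?_
          have hmem : ξ + z₀ ξ / N.capacity e + N.transitTime e ∈
              {x | 0 ≤ x ∧ N.traverse z L₁ x ≤ θ} := ⟨hT.mapsTo hξ.1, hξ.2⟩
          rwa [hs] at hmem
        rw [this]
        simp
      · rw [hs, setIntegral_Icc_zero hρ0, hout ρ hρ0]
        congr 2
        ext ξ
        refine and_congr_right fun hξ => ?_
        have := Set.ext_iff.1 hs (ξ + z₀ ξ / N.capacity e + N.transitTime e)
        simp only [mem_ofPred_eq, mem_Icc] at this
        have h0 : 0 ≤ ξ + z₀ ξ / N.capacity e + N.transitTime e := hT.mapsTo hξ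
        simp only [h0, true_and] at this
        exact this.symm

/-- Every edge lies on at most one path, so the paths can be loaded independently; edges on no path
stay empty. -/
theorem exists_flowOverTime [Finite E] (hN : N.IsParallelPathNetwork) {r : N.STPath → ℝ}
    (hr : ∀ P, 0 ≤ r P) {S : N.STPath → Set ℝ} (hS : ∀ P, IsPeriod (S P))
    (hsum : ∀ θ, 0 ≤ θ → ∑ P, (S P).indicator (fun _ => r P) θ = N.inflowRate) :
    ∃ f : N.FlowOverTime, ∀ P, f.pathInflow P = (S P).indicator fun _ => r P := by
  classical
  choose inflow z h using fun P : N.STPath => exists_isLoaded (N := N) P.edges_nodup (hr P) (hS P)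
  let path : E → Option N.STPath := fun e =>
    if h : ∃ P : N.STPath, e ∈ P.edges then some h.choose else none
  have hpath : ∀ (P : N.STPath) (e : E), e ∈ P.edges → path e = some P := by
    intro P e he
    have hex : ∃ P : N.STPath, e ∈ P.edges := ⟨P, he⟩
    simp only [path, dif_pos hex, Option.some.injEq]
    by_contra hne
    exact hN _ _ hne hex.choose_spec he
  let inflow₀ : E → ℝ → ℝ := fun e => (path e).elim 0 fun P => inflow P e
  let z₀ : E → ℝ → ℝ := fun e => (path e).elim 0 fun P => z P e
  have hload : ∀ P, N.IsLoaded inflow₀ z₀ P.edges ((S P).indicator fun _ => r P) := fun P =>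
    (h P).congr (fun e he => by simp [inflow₀, hpath P e he])
      fun e he => by simp [z₀, hpath P e he]
  have hnone : ∀ e, (¬ ∃ P : N.STPath, e ∈ P.edges) → inflow₀ e = 0 ∧ z₀ e = 0 := by
    intro e he
    simp [inflow₀, z₀, path, he]
  have hall : ∀ e, (∀ θ, 0 ≤ θ → 0 ≤ inflow₀ e θ) ∧
      (∀ θ, 0 ≤ θ → IntervalIntegrable (inflow₀ e) volume 0 θ) ∧
      IsQueue (N.capacity e) (inflow₀ e) (z₀ e) ∧
      ∀ θ, 0 ≤ θ → ∫ x in (0 : ℝ)..θ, inflow₀ e x =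
        ∑ P : N.STPath with e ∈ P.edges,
          ∫ ξ in {ξ : ℝ | 0 ≤ ξ ∧ N.arrivalTime z₀ P (N.tail e) ξ ≤ θ},
            (S P).indicator (fun _ => r P) ξ := by
    intro e
    by_cases he : ∃ P : N.STPath, e ∈ P.edges
    · obtain ⟨P, hP⟩ := he
      obtain ⟨L₁, L₂, hL⟩ := List.append_of_mem hP
      obtain ⟨h1, h2, h3, h4⟩ := hload P L₁ e L₂ hL
      refine ⟨h1, h2, h3, fun θ hθ => ?_⟩
      rw [h4 θ hθ, Finset.sum_eq_single P, arrivalTime_tail _ P hL]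
      · intro Q hQ hQP
        exact absurd hP (fun h => hN Q P hQP (Finset.mem_filter.1 hQ).2 h)
      · intro h
        exact absurd (Finset.mem_filter.2 ⟨Finset.mem_univ P, hP⟩) h
    · obtain ⟨h1, h2⟩ := hnone e he
      rw [h1, h2]
      refine ⟨fun _ _ => le_rfl, fun _ _ => intervalIntegrable_const, ⟨continuousOn_const, ?_⟩, ?_⟩
      · intro θ _
        simp [(N.capacity_pos e).le]
      · intro θ _
        rw [Finset.sum_eq_zero]
        · simp
        · intro P hP
          exact absurd ⟨P, (Finset.mem_filter.1 hP).2⟩ he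
  refine ⟨
    { pathInflow := fun P => (S P).indicator fun _ => r P
      pathInflow_measurable := fun P => measurable_const.indicator (hS P).measurableSet
      pathInflow_nonneg := fun P θ _ => indicator_nonneg (fun _ _ => hr P) θ
      sum_pathInflow := hsum
      edgeInflow := inflow₀
      edgeInflow_nonneg := fun e => (hall e).1
      edgeInflow_integrable := fun e => (hall e).2.1
      queue := z₀
      isQueue := fun e => (hall e).2.2.1
      integral_edgeInflow := fun e θ hθ => ?_ }, fun P => rfl⟩
  convert (hall e).2.2.2 θ hθ

end FlowNetwork

namespace FlowNetwork

open MeasureTheory Set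

variable {V E : Type*} [Finite E] {N : FlowNetwork V E}

/-! ### Sequential Nash flows attain the minimum -/

section Sequential

open Classical in
/-- The time at which a path of a list starts to be used if the paths are used up one after the
other, starting at the end of the list. -/
noncomputable def seqStart : List N.STPath → N.STPath → ℝ
  | [], _ => 0
  | Q :: l, P => if P = Q then seqUseUp l else seqStart l P

omit [Finite E] in
theorem seqStart_cons_self (Q : N.STPath) (l : List N.STPath) :
    seqStart (Q :: l) Q = seqUseUp l := by simp [seqStart]

omit [Finite E] in
theorem seqStart_cons_of_ne {P Q : N.STPath} (h : P ≠ Q) (l : List N.STPath) :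
    seqStart (Q :: l) P = seqStart l P := by simp [seqStart, h]

theorem seqStart_nonneg (l : List N.STPath) (P : N.STPath) : 0 ≤ seqStart l P := by
  induction l with
  | nil => exact le_rfl
  | cons Q l ih =>
    by_cases h : P = Q
    · rw [h, seqStart_cons_self]
      exact seqUseUp_nonneg l
    · rwa [seqStart_cons_of_ne h]

theorem useUp_seqStart_le {l : List N.STPath} {P : N.STPath} (hP : P ∈ l) :
    P.useUp (seqStart l P) ≤ seqUseUp l := by
  induction l with
  | nil => simp at hP
  | cons Q l ih =>
    by_cases h : P = Q
    · rw [h, seqStart_cons_self]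
      exact le_rfl
    · rw [seqStart_cons_of_ne h]
      exact (ih ((List.mem_cons.1 hP).resolve_left h)).trans (Q.le_useUp _)

theorem useUp_seqStart_le_of_cost_lt {l : List N.STPath}
    (hl : l.Pairwise fun P Q => Q.cost ≤ P.cost) {P Q : N.STPath} (hP : P ∈ l) (hQ : Q ∈ l)
    (h : Q.cost < P.cost) : Q.useUp (seqStart l Q) ≤ seqStart l P := by
  induction l with
  | nil => simp at hP
  | cons R l ih =>
    have hl := List.pairwise_cons.1 hl
    by_cases hPR : P = R
    · have hQR : Q ≠ R := by
        rintro rfl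
        exact absurd h (by rw [hPR]; exact lt_irrefl _)
      rw [hPR, seqStart_cons_self, seqStart_cons_of_ne hQR]
      exact useUp_seqStart_le ((List.mem_cons.1 hQ).resolve_left hQR)
    · have hPl := (List.mem_cons.1 hP).resolve_left hPR
      have hQR : Q ≠ R := by
        rintro rfl
        exact absurd h (not_lt.2 (hl.1 P hPl))
      rw [seqStart_cons_of_ne hPR, seqStart_cons_of_ne hQR]
      exact ih hl.2 hPl ((List.mem_cons.1 hQ).resolve_left hQR)

theorem sum_indicator_seqStart {l : List N.STPath} (hl : l.Nodup) (r : ℝ) {θ : ℝ} (hθ : 0 ≤ θ) :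
    (l.map fun P => (Ico (seqStart l P) (P.useUp (seqStart l P))).indicator (fun _ => r) θ).sum =
      (Iio (seqUseUp l)).indicator (fun _ => r) θ := by
  induction l with
  | nil => simp [seqUseUp, hθ]
  | cons Q l ih =>
    have hl := List.nodup_cons.1 hl
    have h1 : (l.map fun P => (Ico (seqStart (Q :: l) P)
        (P.useUp (seqStart (Q :: l) P))).indicator (fun _ => r) θ) =
        l.map fun P => (Ico (seqStart l P) (P.useUp (seqStart l P))).indicator (fun _ => r) θ := by
      refine List.map_congr_left fun P hP => ?_
      rw [seqStart_cons_of_ne (by rintro rfl; exact hl.1 hP)]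
    rw [List.map_cons, List.sum_cons, h1, ih hl.2, seqStart_cons_self]
    have h2 : seqUseUp (Q :: l) = Q.useUp (seqUseUp l) := rfl
    have h3 := Q.le_useUp (seqUseUp l)
    rw [h2]
    simp only [indicator_apply, mem_Ico, mem_Iio]
    rcases lt_or_ge θ (seqUseUp l) with h | h
    · simp [h, not_le.2 h, h.trans_le h3]
    · simp [h, not_lt.2 h]

namespace FlowOverTime

variable (f : N.FlowOverTime)

theorem cumInflow_sub_le (P : N.STPath) {s θ : ℝ} (hs : 0 ≤ s) (hsθ : s ≤ θ) :
    f.cumInflow P θ - f.cumInflow P s ≤ N.inflowRate * (θ - s) := by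
  have h1 := f.sum_cumInflow hs
  have h2 := f.sum_cumInflow (hs.trans hsθ)
  have h3 : f.cumInflow P θ - f.cumInflow P s ≤ ∑ Q, (f.cumInflow Q θ - f.cumInflow Q s) :=
    Finset.single_le_sum (f := fun Q => f.cumInflow Q θ - f.cumInflow Q s)
      (fun Q _ => sub_nonneg.2 (f.cumInflow_monotoneOn Q hs (hs.trans hsθ) hsθ))
      (Finset.mem_univ P)
  rw [Finset.sum_sub_distrib, h1, h2] at h3
  linarith

/-- If `slack ≤ α` or the capacity is at least `u`, the transit time alone makes the particle late.
Otherwise the queue built since `α` does. -/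
theorem deadline_le_sinkArrival_useUp (hN : N.IsParallelPathNetwork) {P : N.STPath} {α : ℝ}
    (hα : 0 ≤ α) (h : ∀ x, α ≤ x → x < P.useUp α → f.pathInflow P x = N.inflowRate) :
    N.deadline ≤ f.sinkArrival P (P.useUp α) := by
  have hle := P.le_useUp α
  have hβ := hα.trans hle
  have hF : f.cumInflow P (P.useUp α) - f.cumInflow P α = N.inflowRate * (P.useUp α - α) := by
    unfold cumInflow
    rw [intervalIntegral.integral_interval_sub_left (f.pathInflow_intervalIntegrable P hβ)
      (f.pathInflow_intervalIntegrable P hα), intervalIntegral.integral_of_le hle,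
      integral_Ioc_eq_integral_Ioo, setIntegral_congr_fun measurableSet_Ioo
        (g := fun _ => N.inflowRate) fun x hx => h x hx.1.le hx.2, setIntegral_const,
      Real.volume_real_Ioo_of_le hle, smul_eq_mul, mul_comm]
  have h1 := f.le_sinkArrival hN P hα hle
  have h2 := (f.travelBounds hN P).add_le _ hβ
  change P.transitTime + P.useUp α ≤ f.sinkArrival P (P.useUp α) at h2
  rw [hF] at h1
  have hd : N.deadline = P.transitTime + P.slack := by
    unfold STPath.slack
    ring
  rcases le_total P.slack α with hs | hs
  · linarith
  have hu : P.useUp α = α + P.share * (P.slack - α) := by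
    unfold STPath.useUp
    rw [max_eq_left (sub_nonneg.2 hs)]
  rcases le_total 1 (P.capacity / N.inflowRate) with hc | hc
  · rw [STPath.share, min_eq_left hc] at hu
    linarith
  · rw [STPath.share, min_eq_right hc] at hu
    have h3 : N.inflowRate * (P.useUp α - α) / P.capacity = P.slack - α := by
      have h4 := P.capacity_pos.ne'
      have h5 := N.inflowRate_pos.ne'
      rw [hu]
      field_simp
      ring
    rw [h3] at h1
    linarith

theorem sinkArrival_lt_deadline (hN : N.IsParallelPathNetwork) {P : N.STPath} {α θ : ℝ}
    (hα : 0 ≤ α) (h : ∀ x, 0 < x → x < α → f.pathInflow P x = 0) (hαθ : α ≤ θ)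
    (hθ : θ < P.useUp α) : f.sinkArrival P θ < N.deadline := by
  have hu := N.inflowRate_pos
  have hc := P.capacity_pos
  have hρ := P.share_pos
  obtain ⟨s, hs0, hsθ, hs⟩ := f.exists_sinkArrival_le hN P (hα.trans hαθ)
  have hFα : f.cumInflow P α = 0 := f.cumInflow_eq_zero hα h
  have hslack : α < P.slack := by
    by_contra! hle
    rw [STPath.useUp, max_eq_right (sub_nonpos.2 hle), mul_zero, add_zero] at hθ
    exact absurd hθ (not_lt.2 hαθ)
  rw [STPath.useUp, max_eq_left (sub_nonneg.2 hslack.le)] at hθ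
  -- Even the full inflow `u` cannot fill the path by `θ`. For starting times before `α` the claim
  -- follows from the one at `α`, since nothing entered earlier.
  have key : ∀ s, α ≤ s → s ≤ θ → f.cumInflow P θ - f.cumInflow P s <
      P.capacity * (P.slack - s) := by
    intro s hαs hsθ
    have h1 := f.cumInflow_sub_le P (hα.trans hαs) hsθ
    have h2 : θ - s < P.share * (P.slack - s) := by
      have := mul_le_mul_of_nonneg_right P.share_le_one (sub_nonneg.2 hαs)
      linarith
    have h3 : 0 ≤ P.slack - s := by
      by_contra! hneg
      have := mul_neg_of_pos_of_neg hρ hneg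
      linarith
    have h4 := mul_le_mul_of_nonneg_right P.inflowRate_mul_share_le h3
    have h5 := mul_lt_mul_of_pos_left h2 hu
    linarith
  have h6 : f.cumInflow P θ - f.cumInflow P s < P.capacity * (P.slack - s) := by
    rcases le_total α s with hαs | hαs
    · exact key s hαs hsθ
    · have h1 := key α le_rfl hαθ
      have h2 := f.cumInflow_monotoneOn P self_mem_Ici hs0 hs0
      have h3 : f.cumInflow P 0 = 0 := by simp [cumInflow]
      have h4 : P.capacity * (P.slack - α) ≤ P.capacity * (P.slack - s) := by gcongr
      linarith
  rw [mul_comm, ← div_lt_iff₀ hc] at h6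
  unfold STPath.slack at h6
  linarith

end FlowOverTime

theorem IsCostOrder.exists_isNash (hN : N.IsParallelPathNetwork) [Nonempty N.STPath]
    {l : List N.STPath} (hl : IsCostOrder l) :
    ∃ f : N.FlowOverTime, f.IsNash ∧ f.throughput N.deadline = N.inflowRate * seqUseUp l := by
  classical
  obtain ⟨P₀, l₀, hl₀⟩ := List.exists_cons_of_ne_nil
    (List.ne_nil_of_mem (hl.mem (Classical.arbitrary N.STPath)))
  set α := seqStart l with hα
  have hα0 : ∀ P, 0 ≤ α P := seqStart_nonneg l
  -- The last path used, `P₀`, keeps the inflow forever, so that the rates always add up to `u`.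
  -- This respects the Nash condition, as by then every path costs `∞`.
  set S : N.STPath → Set ℝ := fun P =>
    if P = P₀ then Ici (α P) else Ico (α P) (P.useUp (α P)) with hS
  have hIco : ∀ P, Ico (α P) (P.useUp (α P)) ⊆ S P := by
    intro P
    simp only [hS]
    split_ifs
    · exact Ico_subset_Ici_self
    · exact subset_rfl
  have hIci : ∀ P, S P ⊆ Ici (α P) := by
    intro P
    simp only [hS]
    split_ifs
    · exact subset_rfl
    · exact Ico_subset_Ici_self
  have hlast : ∀ P θ, θ ∈ S P → θ < seqUseUp l → θ < P.useUp (α P) := by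
    intro P θ hθ hlt
    by_cases h : P = P₀
    · rw [h, hα, hl₀, seqStart_cons_self]
      rwa [hl₀] at hlt
    · simp only [hS, if_neg h] at hθ
      exact hθ.2
  have hcover := fun θ (hθ : 0 ≤ θ) => sum_indicator_seqStart hl.nodup N.inflowRate hθ
  simp only [hl.sum_map] at hcover
  have hsum : ∀ θ, 0 ≤ θ → ∑ P, (S P).indicator (fun _ => N.inflowRate) θ = N.inflowRate := by
    intro θ hθ
    have h1 : ∑ P, (S P).indicator (fun _ => N.inflowRate) θ =
        ∑ P, ((Ico (α P) (P.useUp (α P))).indicator (fun _ => N.inflowRate) θ +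
          if P = P₀ then (Ici (seqUseUp l)).indicator (fun _ => N.inflowRate) θ else 0) := by
      refine Finset.sum_congr rfl fun P _ => ?_
      by_cases h : P = P₀
      · have h2 : P₀.useUp (α P₀) = seqUseUp l := by rw [hα, hl₀, seqStart_cons_self]; rfl
        have h3 := P₀.le_useUp (α P₀)
        simp only [hS, h, ← h2, indicator_apply, mem_Ici, mem_Ico]
        rcases lt_or_ge θ (P₀.useUp (α P₀)) with h4 | h4
        · simp [h4, not_le.2 h4]
        · simp [h4, not_lt.2 h4, h3.trans h4]
      · simp [hS, if_neg h]
    rw [h1, Finset.sum_add_distrib, hcover θ hθ, Finset.sum_ite_eq' Finset.univ P₀]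
    rcases lt_or_ge θ (seqUseUp l) with h4 | h4
    · simp [h4, not_le.2 h4]
    · simp [h4, not_lt.2 h4]
  obtain ⟨f, hf⟩ := exists_flowOverTime hN (r := fun _ => N.inflowRate)
    (fun _ => N.inflowRate_pos.le) (S := S) (fun P => by
      refine ⟨α P, hα0 P, ?_⟩
      simp only [hS]
      split_ifs
      · exact Or.inl rfl
      · exact Or.inr ⟨_, P.le_useUp _, rfl⟩) hsum
  have hmiss : ∀ P θ, P.useUp (α P) ≤ θ → N.deadline ≤ f.sinkArrival P θ := by
    intro P θ hθ
    have h1 := f.deadline_le_sinkArrival_useUp hN (hα0 P) fun x h1 h2 => by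
      rw [hf, indicator_of_mem (hIco P ⟨h1, h2⟩)]
    have h0 := (hα0 P).trans (P.le_useUp _)
    exact h1.trans ((f.isTimeMap_sinkArrival hN P).monotoneOn h0 (h0.trans hθ) hθ)
  have hmeet : ∀ P θ, α P ≤ θ → θ < P.useUp (α P) → f.sinkArrival P θ < N.deadline :=
    fun P θ h1 h2 => f.sinkArrival_lt_deadline hN (hα0 P) (fun x _ hx => by
      rw [hf, indicator_of_notMem fun h => absurd (hIci P h) (not_le.2 hx)]) h1 h2
  have hall : ∀ θ, seqUseUp l ≤ θ → f.AllMiss θ := fun θ hθ P =>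
    hmiss P θ ((useUp_seqStart_le (hl.mem P)).trans hθ)
  have hnash : f.IsNash := by
    intro θ hθ P hP Q
    have hPS : θ ∈ S P := by
      by_contra h
      rw [hf, indicator_of_notMem h] at hP
      exact lt_irrefl _ hP
    unfold FlowOverTime.particleCost
    rcases lt_or_ge θ (seqUseUp l) with hlt | hge
    · rw [if_pos (hmeet P θ (hIci P hPS) (hlast P θ hPS hlt))]
      split_ifs with hQ
      · rw [WithTop.coe_le_coe]
        by_contra! hcost
        have h1 := useUp_seqStart_le_of_cost_lt hl.pairwise (hl.mem P) (hl.mem Q) hcost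
        exact absurd hQ (not_lt.2 (hmiss Q θ (h1.trans (hIci P hPS))))
      · exact le_top
    · rw [if_neg (not_lt.2 (hall θ hge P)), if_neg (not_lt.2 (hall θ hge Q))]
  refine ⟨f, hnash, hnash.throughput_eq hN (seqUseUp_nonneg l) (hall _ le_rfl) ?_⟩
  intro θ hθ hlt hmissθ
  have h1 := hcover θ hθ
  rw [indicator_of_mem (show θ ∈ Iio (seqUseUp l) from hlt)] at h1
  obtain ⟨P, -, hP⟩ := Finset.exists_ne_zero_of_sum_ne_zero (h1 ▸ N.inflowRate_pos.ne')
  have hmem := mem_of_indicator_ne_zero hP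
  exact absurd (hmeet P θ hmem.1 hmem.2) (not_lt.2 (hmissθ P))

theorem exists_isLeast_nashThroughputs (hN : N.IsParallelPathNetwork) [Nonempty N.STPath] :
    ∃ l : List N.STPath, IsCostOrder l ∧
      IsLeast N.nashThroughputs (N.inflowRate * seqUseUp l) := by
  obtain ⟨l, hl, hmin⟩ := exists_isCostOrder_minimal (N := N)
  refine ⟨l, hl, hl.exists_isNash hN, ?_⟩
  rintro _ ⟨f, hf, rfl⟩
  obtain ⟨l', hl', hle⟩ := hf.exists_isCostOrder_le hN
  exact (mul_le_mul_of_nonneg_left (hmin l' hl') N.inflowRate_pos.le).trans hle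

end Sequential

/-! ### The greedy flow and attainment of the optimal makespan -/

section Optimal

theorem exists_constant_flow (hN : N.IsParallelPathNetwork) {x : N.STPath → ℝ}
    (hx : ∀ P, 0 ≤ x P) (hsum : ∑ P, x P = N.inflowRate) :
    ∃ f : N.FlowOverTime, ∀ T, 0 ≤ T →
      ∑ P : N.STPath, min (x P) P.capacity * max (T - P.transitTime) 0 ≤ f.throughput T := by
  obtain ⟨f, hf⟩ := exists_flowOverTime hN hx (S := fun _ => Ici 0)
    (fun P => ⟨0, le_rfl, Or.inl rfl⟩) (fun θ hθ => by
      simpa [indicator_of_mem (show θ ∈ Ici (0 : ℝ) from hθ)] using hsum)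
  refine ⟨f, fun T hT => Finset.sum_le_sum fun P _ => ?_⟩
  obtain ⟨κ, hκ0, hκ, -, hiff⟩ := (f.isTimeMap_sinkArrival hN P).exists_first T
  rw [f.setIntegral_of_iff hκ0 hiff]
  have hF : ∀ θ, 0 ≤ θ → f.cumInflow P θ = x P * θ := by
    intro θ hθ
    rw [FlowOverTime.cumInflow, hf, integral_indicator_eq measurableSet_Ici _ hθ,
      inter_eq_left.2 Icc_subset_Ici_self, Real.volume_real_Icc_of_le hθ]
    ring
  obtain ⟨s, hs0, hsκ, hs⟩ := f.exists_sinkArrival_le hN P hκ0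
  rw [hF κ hκ0] at hs ⊢
  rw [hF s hs0] at hs
  have hc := P.capacity_pos
  have hmin0 : 0 ≤ min (x P) P.capacity := le_min (hx P) hc.le
  rcases le_total (T - P.transitTime) 0 with h | h
  · rw [max_eq_right h, mul_zero]
    exact mul_nonneg (hx P) hκ0
  · rw [max_eq_left h]
    have h1 : T - P.transitTime ≤ s + (x P * κ - x P * s) / P.capacity := by linarith
    have h2 := mul_le_mul_of_nonneg_left h1 hmin0
    have h3 : min (x P) P.capacity * s ≤ x P * s :=
      mul_le_mul_of_nonneg_right (min_le_left _ _) hs0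
    have h4 : 0 ≤ (x P * κ - x P * s) / P.capacity :=
      div_nonneg (by rw [← mul_sub]; exact mul_nonneg (hx P) (sub_nonneg.2 hsκ)) hc.le
    have h5 := mul_le_mul_of_nonneg_right (min_le_right (x P) P.capacity) h4
    rw [mul_div_cancel₀ _ hc.ne'] at h5
    linarith

/-- Filling the paths greedily in the order of their transit times is optimal. -/
theorem exists_greedy {ι : Type*} [Fintype ι] [Nonempty ι] {ν τ : ι → ℝ} {u : ℝ}
    (hν : ∀ i, 0 < ν i) (hu : 0 < u) :
    ∃ x : ι → ℝ, (∀ i, 0 ≤ x i) ∧ ∑ i, x i = u ∧ ∀ T, ∃ t, 0 ≤ t ∧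
      u * t + ∑ i, ν i * max (T - τ i - t) 0 ≤ ∑ i, min (x i) (ν i) * max (T - τ i) 0 := by
  classical
  rcases le_or_gt (∑ i, ν i) u with hle | hlt
  · refine ⟨fun i => ν i + if i = Classical.arbitrary ι then u - ∑ i, ν i else 0, fun i => ?_, ?_,
      fun T => ⟨0, le_rfl, ?_⟩⟩
    · have := (hν i).le
      dsimp only
      split_ifs <;> linarith
    · rw [Finset.sum_add_distrib, Finset.sum_ite_eq' Finset.univ]
      simp
    · simp only [mul_zero, sub_zero, zero_add]
      refine Finset.sum_le_sum fun i _ => mul_le_mul_of_nonneg_right ?_ (le_max_right _ _)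
      refine le_min ?_ le_rfl
      split_ifs <;> linarith
  · have hne : (Finset.univ.filter fun k => u < ∑ i with τ i ≤ τ k, ν i).Nonempty := by
      obtain ⟨k, hk⟩ := Finite.exists_max τ
      refine ⟨k, Finset.mem_filter.2 ⟨Finset.mem_univ k, ?_⟩⟩
      rwa [Finset.filter_true_of_mem fun i _ => hk i]
    obtain ⟨k, hk, hkmin⟩ := Finset.exists_min_image _ τ hne
    have hk := (Finset.mem_filter.1 hk).2
    set A := ∑ i with τ i < τ k, ν i with hA
    set B := ∑ i with τ i = τ k, ν i with hB
    have hAB : ∑ i with τ i ≤ τ k, ν i = A + B := by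
      rw [hA, hB, ← Finset.sum_union]
      · refine Finset.sum_congr ?_ fun _ _ => rfl
        ext i
        simp [le_iff_lt_or_eq]
      · rw [Finset.disjoint_filter]
        exact fun i _ h1 h2 => h1.ne h2
    have hAu : A ≤ u := by
      by_contra! hlt
      have hne : (Finset.univ.filter fun i => τ i < τ k).Nonempty := by
        rw [Finset.nonempty_iff_ne_empty]
        intro h
        rw [hA, h, Finset.sum_empty] at hlt
        exact absurd hlt (not_lt.2 hu.le)
      obtain ⟨j, hj, hjmax⟩ := Finset.exists_max_image _ τ hne
      have hj := (Finset.mem_filter.1 hj).2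
      refine absurd (hkmin j (Finset.mem_filter.2 ⟨Finset.mem_univ j, ?_⟩)) (not_le.2 hj)
      refine hlt.trans_eq (Finset.sum_congr ?_ fun _ _ => rfl)
      ext i
      simp only [Finset.mem_filter, Finset.mem_univ, true_and]
      exact ⟨fun h => hjmax i (by simpa using h), fun h => h.trans_lt hj⟩
    have hBpos : 0 < B :=
      Finset.sum_pos (fun i _ => hν i) ⟨k, by simp⟩
    have hlam0 : 0 ≤ (u - A) / B := div_nonneg (sub_nonneg.2 hAu) hBpos.le
    have hlam1 : (u - A) / B ≤ 1 := by
      rw [div_le_one hBpos]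
      linarith
    set x : ι → ℝ := fun i =>
      if τ i < τ k then ν i else if τ i = τ k then (u - A) / B * ν i else 0 with hx
    have hx0 : ∀ i, 0 ≤ x i := by
      intro i
      have := (hν i).le
      simp only [hx]
      split_ifs <;> positivity
    have hxν : ∀ i, x i ≤ ν i := by
      intro i
      simp only [hx]
      split_ifs
      · exact le_rfl
      · exact mul_le_of_le_one_left (hν i).le hlam1
      · exact (hν i).le
    have hxsum : ∑ i, x i = u := by
      have h1 : ∀ i, x i = (if τ i < τ k then ν i else 0) +
          (u - A) / B * (if τ i = τ k then ν i else 0) := by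
        intro i
        rcases lt_trichotomy (τ i) (τ k) with h | h | h
        · simp [hx, h, h.ne]
        · simp [hx, h]
        · simp [hx, h.not_gt, h.ne']
      simp only [h1]
      rw [Finset.sum_add_distrib, ← Finset.mul_sum, ← Finset.sum_filter, ← Finset.sum_filter,
        ← hA, ← hB, div_mul_cancel₀ _ hBpos.ne']
      ring
    -- The split time `max (T - τ k) 0` makes the dual bound tight term by term. Only this `t`
    -- depends on `T`; `x` does not.
    refine ⟨x, hx0, hxsum, fun T => ⟨max (T - τ k) 0, le_max_right _ _, ?_⟩⟩
    rw [← hxsum, Finset.sum_mul, ← Finset.sum_add_distrib]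
    refine Finset.sum_le_sum fun i _ => ?_
    rw [min_eq_left (hxν i)]
    have h1 := le_max_left (T - τ k) 0
    have h2 := le_max_right (T - τ k) 0
    rcases lt_or_ge (τ i) (τ k) with h | h
    · have h3 : x i = ν i := by simp [hx, h]
      rw [h3, ← mul_add]
      refine mul_le_mul_of_nonneg_left ?_ (hν i).le
      rcases le_total (T - τ k) 0 with h4 | h4
      · rw [max_eq_right h4, sub_zero, zero_add]
      · rw [max_eq_left h4, max_eq_left (by linarith), max_eq_left (by linarith)]
        linarith
    · rw [max_eq_right (by linarith : T - τ i - max (T - τ k) 0 ≤ 0), mul_zero, add_zero]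
      rcases h.eq_or_lt with h | h
      · rw [h]
      · have h3 : x i = 0 := by simp [hx, h.not_gt, h.ne']
        simp [h3]

/-- One greedy flow is optimal for all `T`, so feasibility is a closed condition on a continuous
function of `T`. -/
theorem isLeast_feasibleMakespans (hN : N.IsParallelPathNetwork) [Nonempty N.STPath] {M : ℝ}
    (hM : (N.feasibleMakespans M).Nonempty) :
    IsLeast (N.feasibleMakespans M) (N.optimalMakespan M) := by
  obtain ⟨x, hx0, hxsum, hx⟩ := exists_greedy (ι := N.STPath) (ν := fun P => P.capacity)
    (τ := fun P => P.transitTime) (fun P => P.capacity_pos) N.inflowRate_pos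
  obtain ⟨f, hf⟩ := exists_constant_flow hN hx0 hxsum
  have heq : N.feasibleMakespans M = Ici 0 ∩ {T | M ≤
      ∑ P : N.STPath, min (x P) P.capacity * max (T - P.transitTime) 0} := by
    ext T
    refine and_congr_right fun hT => ⟨?_, fun h => ⟨f, le_trans h (hf T hT)⟩⟩
    rintro ⟨g, hg⟩
    obtain ⟨t, ht, hle⟩ := hx T
    exact hg.trans ((g.throughput_le hN T ht).trans hle)
  have hcl : IsClosed (N.feasibleMakespans M) := by
    rw [heq]
    exact isClosed_Ici.inter (isClosed_le continuous_const (by fun_prop))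
  have hbdd : BddBelow (N.feasibleMakespans M) := ⟨0, fun T hT => hT.1⟩
  exact ⟨hcl.csInf_mem hM hbdd, fun T hT => csInf_le hbdd hT⟩

end Optimal

end FlowNetwork

namespace FlowNetwork

open MeasureTheory Set

/-! ### The bound `e / (e - 1)` -/

section Bound

variable {V E : Type*} [Finite E] {N : FlowNetwork V E}

/-- Each step from `a` to `a'` contributes a lower Riemann term `(a' - a) / (D - a)` of the integral
of `1 / (D - y)`, whence the logarithm. -/
theorem sum_share_mul_le (l : List N.STPath) {x : ℝ}
    (hx : seqUseUp l ≤ x) (hxD : x < N.deadline) :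
    (l.map fun P => P.share * max (P.slack - x) 0).sum ≤
      (N.deadline - x) * (Real.log N.deadline - Real.log (N.deadline - seqUseUp l)) := by
  induction l with
  | nil => simp [seqUseUp]
  | cons P l ih =>
    set a := seqUseUp l with ha
    have hb : seqUseUp (P :: l) = P.useUp a := rfl
    rw [hb] at hx ⊢
    have hab := P.le_useUp a
    have ih := ih (hab.trans hx)
    have hbD : 0 < N.deadline - P.useUp a := by linarith
    have haD : 0 < N.deadline - a := by linarith
    have hlog : (P.useUp a - a) / (N.deadline - a) ≤
        Real.log (N.deadline - a) - Real.log (N.deadline - P.useUp a) := by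
      have h1 := Real.log_le_sub_one_of_pos (div_pos hbD haD)
      rw [Real.log_div hbD.ne' haD.ne'] at h1
      have h2 : (P.useUp a - a) / (N.deadline - a) =
          1 - (N.deadline - P.useUp a) / (N.deadline - a) := by
        field_simp
        ring
      linarith
    have key : P.share * max (P.slack - x) 0 ≤
        (N.deadline - x) * ((P.useUp a - a) / (N.deadline - a)) := by
      rcases le_total (P.slack - x) 0 with h | h
      · rw [max_eq_right h, mul_zero]
        exact mul_nonneg (by linarith) (div_nonneg (by linarith) haD.le)
      · have h3 : P.useUp a - a = P.share * (P.slack - a) := by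
          rw [STPath.useUp, max_eq_left (by linarith)]
          ring
        rw [max_eq_left h, h3, ← mul_div_assoc, le_div_iff₀ haD]
        -- Cross-multiplied, the claim is `(D - x) * (slack - a) - (slack - x) * (D - a) = (D -
        -- slack) * (x - a) ≥ 0`.
        have h4 : 0 ≤ P.share * ((N.deadline - P.slack) * (x - a)) :=
          mul_nonneg P.share_pos.le
            (mul_nonneg (sub_nonneg.2 P.slack_le) (by linarith))
        linarith
    have h5 := mul_le_mul_of_nonneg_left hlog (by linarith : 0 ≤ N.deadline - x)
    rw [List.map_cons, List.sum_cons]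
    linarith

/-- A path with capacity at least `u` never queues and stays useful up to its slack. Its excess
capacity therefore drops out of the bound beyond `Θ`. -/
theorem slack_le_seqUseUp {l : List N.STPath} {P : N.STPath} (hP : P ∈ l) (h : P.share = 1) :
    P.slack ≤ seqUseUp l := by
  induction l with
  | nil => simp at hP
  | cons Q l ih =>
    rcases List.mem_cons.1 hP with rfl | hP
    · have := le_max_left (P.slack - seqUseUp l) 0
      simp only [seqUseUp, STPath.useUp, h]
      linarith
    · exact (ih hP).trans (Q.le_useUp _)

theorem mul_log_inv_le {y : ℝ} (hy : 0 < y) : -(y * Real.log y) ≤ Real.exp (-1) := by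
  have h1 := Real.log_le_sub_one_of_pos (div_pos (Real.exp_pos (-1)) hy)
  rw [Real.log_div (Real.exp_pos _).ne' hy.ne', Real.log_exp] at h1
  have h2 := mul_le_mul_of_nonneg_left h1 hy.le
  have h3 : y * (Real.exp (-1) / y - 1) = Real.exp (-1) - y := by field_simp
  linarith

theorem IsCostOrder.mul_deadline_le (hN : N.IsParallelPathNetwork) (hD : 0 < N.deadline)
    {l : List N.STPath} (hl : IsCostOrder l) (hpos : 0 < seqUseUp l) {T : ℝ}
    (hT : T ∈ N.feasibleMakespans (N.inflowRate * seqUseUp l)) :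
    (1 - Real.exp (-1)) * N.deadline ≤ T := by
  obtain ⟨hT0, f, hf⟩ := hT
  have hu := N.inflowRate_pos
  rcases le_or_gt N.deadline T with hle | hlt
  · have := mul_nonneg (Real.exp_pos (-1)).le hD.le
    linarith
  set D := N.deadline with hDdef
  set Θ := seqUseUp l with hΘ
  have hΘD : Θ ≤ D := seqUseUp_le hD.le l
  set δ := D - T with hδ
  -- The throughput bound is used at `t = x - δ`, so that `T - τ_P - t = slack - x`. The maximum
  -- keeps both `t ≥ 0` and `x ≥ Θ`.
  set x := max Θ δ with hx
  have hxΘ : Θ ≤ x := le_max_left _ _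
  have hxδ : δ ≤ x := le_max_right _ _
  have hxD : x ≤ D := max_le hΘD (by linarith)
  have h1 := hf.trans (f.throughput_le hN T (sub_nonneg.2 hxδ))
  have h2 : ∀ P : N.STPath, P.capacity * max (T - P.transitTime - (x - δ)) 0 ≤
      N.inflowRate * (P.share * max (P.slack - x) 0) := by
    intro P
    have h3 : T - P.transitTime - (x - δ) = P.slack - x := by
      rw [STPath.slack, hδ]
      ring
    rw [h3]
    rcases le_or_gt (P.slack - x) 0 with h | h
    · simp [max_eq_right h]
    · rcases le_total 1 (P.capacity / N.inflowRate) with hc | hc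
      · have := slack_le_seqUseUp (hl.mem P) (min_eq_left hc)
        linarith
      · rw [STPath.share, min_eq_right hc, ← mul_assoc, mul_div_cancel₀ _ hu.ne']
  have h3 : Θ ≤ x - δ + ∑ P : N.STPath, P.share * max (P.slack - x) 0 := by
    have h4 := Finset.sum_le_sum fun P (_ : P ∈ Finset.univ) => h2 P
    rw [← Finset.mul_sum] at h4
    refine le_of_mul_le_mul_left ?_ hu
    linarith
  rcases hxD.eq_or_lt with hxD | hxD
  · have h4 : ∑ P : N.STPath, P.share * max (P.slack - x) 0 = 0 :=
      Finset.sum_eq_zero fun P _ => by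
        rw [max_eq_right (by rw [hxD]; exact sub_nonpos.2 P.slack_le), mul_zero]
    rcases le_total Θ δ with h | h
    · have : x = δ := max_eq_right h
      linarith
    · have : x = Θ := max_eq_left h
      linarith
  · have h4 := sum_share_mul_le l hxΘ hxD
    rw [hl.sum_map] at h4
    have hDΘ : 0 < D - Θ := by linarith
    rw [← Real.log_div hD.ne' hDΘ.ne'] at h4
    rcases le_or_gt δ Θ with h | h
    · have hxe : x = Θ := max_eq_left h
      rw [hxe] at h3 h4
      have h5 := mul_log_inv_le (div_pos hDΘ hD)
      rw [← inv_div D, Real.log_inv, inv_div] at h5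
      have h6 := mul_le_mul_of_nonneg_left h5 hD.le
      have h7 : D * -((D - Θ) / D * -Real.log (D / (D - Θ))) =
          (D - Θ) * Real.log (D / (D - Θ)) := by
        field_simp
      linarith
    -- This case is contradictory: `log y ≤ y - 1` would give `Θ < Θ`.
    · have hxe : x = δ := max_eq_right h.le
      rw [hxe] at h3 h4
      have h5 := Real.log_le_sub_one_of_pos (div_pos hD hDΘ)
      have h6 : (D - δ) * Real.log (D / (D - Θ)) ≤ (D - δ) * (D / (D - Θ) - 1) :=
        mul_le_mul_of_nonneg_left h5 (by linarith)
      have h7 : (D - δ) * (D / (D - Θ) - 1) < Θ := by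
        have : (D - δ) * (D / (D - Θ) - 1) = (D - δ) * Θ / (D - Θ) := by
          field_simp
          ring
        rw [this, div_lt_iff₀ hDΘ, mul_comm]
        exact mul_lt_mul_of_pos_left (by linarith) hpos
      linarith

theorem makespanPoA_bound (hN : N.IsParallelPathNetwork)
    (hD : ∃ P : N.STPath, P.transitTime < N.deadline) :
    IsLeast N.nashThroughputs N.minNashThroughput ∧
      IsLeast (N.feasibleMakespans N.minNashThroughput)
        (N.optimalMakespan N.minNashThroughput) ∧
      0 < N.optimalMakespan N.minNashThroughput ∧
      N.makespanPoA ≤ Real.exp 1 / (Real.exp 1 - 1) := by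
  obtain ⟨P, hP⟩ := hD
  have : Nonempty N.STPath := ⟨P⟩
  have hD : 0 < N.deadline := P.transitTime_nonneg.trans_lt hP
  obtain ⟨l, hl, hleast⟩ := exists_isLeast_nashThroughputs hN
  have hM : N.minNashThroughput = N.inflowRate * seqUseUp l := hleast.csInf_eq
  have hpos : 0 < seqUseUp l := seqUseUp_pos (hl.mem P) (sub_pos.2 hP)
  have hne : (N.feasibleMakespans N.minNashThroughput).Nonempty := by
    obtain ⟨f, -, hf⟩ := hleast.1
    exact ⟨N.deadline, hD.le, f, by rw [hM, hf]⟩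
  have hopt := isLeast_feasibleMakespans hN hne
  have hbound : (1 - Real.exp (-1)) * N.deadline ≤ N.optimalMakespan N.minNashThroughput := by
    refine hl.mul_deadline_le hN hD hpos ?_
    rw [← hM]
    exact hopt.1
  have he : Real.exp (-1) < 1 := by simp
  have hoptpos : 0 < N.optimalMakespan N.minNashThroughput :=
    (mul_pos (sub_pos.2 he) hD).trans_le hbound
  refine ⟨hM ▸ hleast, hopt, hoptpos, ?_⟩
  have he1 : 1 < Real.exp 1 := by simp
  unfold makespanPoA
  rw [div_le_div_iff₀ hoptpos (sub_pos.2 he1)]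
  have h1 := mul_le_mul_of_nonneg_left hbound (Real.exp_pos 1).le
  have h2 : Real.exp 1 * ((1 - Real.exp (-1)) * N.deadline) =
      N.deadline * (Real.exp 1 - 1) := by
    rw [Real.exp_neg]
    field_simp
  linarith

end Bound

/-! ### Tightness: parallel links -/

section ParallelLinks

variable {n : ℕ} {c : Fin n → NNReal}

theorem parallelLinks_edges (P : (parallelLinks n c).STPath) : ∃ i, P.edges = [i] := by
  have hne := P.edges_ne_nil
  have hn := P.nodup
  rcases h : P.edges with _ | ⟨i, _ | ⟨j, L⟩⟩
  · exact absurd h hne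
  · exact ⟨i, rfl⟩
  · rw [h] at hn
    simp [parallelLinks] at hn

theorem parallelLinks_isParallelPathNetwork : (parallelLinks n c).IsParallelPathNetwork := by
  intro P Q hPQ
  obtain ⟨i, hi⟩ := parallelLinks_edges P
  obtain ⟨j, hj⟩ := parallelLinks_edges Q
  rw [hi, hj, List.disjoint_singleton, List.mem_singleton]
  rintro rfl
  exact hPQ (STPath.ext (hi.trans hj.symm))

/-- The path that consists of one of the parallel links. -/
def linkPath (i : Fin n) : (parallelLinks n c).STPath where
  edges := [i]
  isWalk := ⟨rfl, rfl⟩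
  nodup := by simp [parallelLinks]

theorem card_parallelLinks_stPath : Fintype.card (parallelLinks n c).STPath = n := by
  refine (Fintype.card_of_bijective (f := linkPath (c := c)) ⟨?_, ?_⟩).symm.trans
    (Fintype.card_fin n)
  · intro i j h
    simpa [linkPath] using congrArg STPath.edges h
  · intro P
    obtain ⟨i, hi⟩ := parallelLinks_edges P
    exact ⟨i, STPath.ext hi.symm⟩

theorem parallelLinks_transitTime (P : (parallelLinks n c).STPath) : P.transitTime = 0 := by
  obtain ⟨i, hi⟩ := parallelLinks_edges P
  simp [STPath.transitTime, hi, parallelLinks]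

theorem parallelLinks_capacity (P : (parallelLinks n c).STPath) :
    P.capacity = 1 / (n : ℝ) := by
  obtain ⟨e, -, he⟩ := P.exists_capacity_eq
  exact he.symm

theorem parallelLinks_seqUseUp (hn : 0 < n) (l : List (parallelLinks n c).STPath) :
    seqUseUp l = 1 - (1 - 1 / (n : ℝ)) ^ l.length := by
  have h1 : 1 / (n : ℝ) ≤ 1 := by
    rw [div_le_one (by exact_mod_cast hn)]
    exact_mod_cast hn
  induction l with
  | nil => simp [seqUseUp]
  | cons P l ih =>
    have hshare : P.share = 1 / (n : ℝ) := by
      rw [STPath.share, parallelLinks_capacity]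
      simpa [parallelLinks] using h1
    have hslack : P.slack = 1 := by
      rw [STPath.slack, parallelLinks_transitTime]
      simp [parallelLinks]
    have h2 : 0 ≤ (1 - 1 / (n : ℝ)) ^ l.length := pow_nonneg (sub_nonneg.2 h1) _
    rw [seqUseUp, STPath.useUp, ih, hshare, hslack, max_eq_left (by linarith), List.length_cons,
      pow_succ]
    ring

theorem parallelLinks_makespanPoA (hn : 0 < n) :
    (parallelLinks n c).makespanPoA = 1 / (1 - (1 - 1 / (n : ℝ)) ^ n) := by
  have hN := parallelLinks_isParallelPathNetwork (n := n) (c := c)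
  have : Nonempty (parallelLinks n c).STPath := ⟨linkPath ⟨0, hn⟩⟩
  have hn' : (n : ℝ) ≠ 0 := by exact_mod_cast hn.ne'
  obtain ⟨l, hl, hleast⟩ := exists_isLeast_nashThroughputs hN
  have hlen : l.length = n := by
    have h := hl.sum_map fun _ => 1
    rw [List.map_const', List.sum_replicate, Finset.sum_const, Finset.card_univ,
      card_parallelLinks_stPath] at h
    simpa using h
  have hΘ := parallelLinks_seqUseUp hn l
  rw [hlen] at hΘ
  have hΘ0 := seqUseUp_nonneg l
  have hM : (parallelLinks n c).minNashThroughput = seqUseUp l :=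
    hleast.csInf_eq.trans (one_mul _)
  rw [← hΘ]
  -- The total capacity is `1 = u` and there is no transit time: by time `T` at most `T` units
  -- arrive, and splitting the inflow evenly achieves this without queues.
  have hopt : IsLeast ((parallelLinks n c).feasibleMakespans (seqUseUp l)) (seqUseUp l) := by
    constructor
    · obtain ⟨f, hf⟩ := exists_constant_flow hN (x := fun _ => 1 / (n : ℝ))
        (fun _ => by positivity) (by
          rw [Finset.sum_const, Finset.card_univ, card_parallelLinks_stPath, nsmul_eq_mul,
            mul_one_div_cancel hn']
          rfl)
      refine ⟨hΘ0, f, le_trans (le_of_eq ?_) (hf _ hΘ0)⟩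
      simp only [parallelLinks_capacity, parallelLinks_transitTime, min_self, sub_zero]
      rw [max_eq_left hΘ0, Finset.sum_const, Finset.card_univ, card_parallelLinks_stPath,
        nsmul_eq_mul, ← mul_assoc, mul_one_div_cancel hn', one_mul]
    · rintro T ⟨hT, f, hf⟩
      refine (hf.trans (f.throughput_le hN T le_rfl)).trans (le_of_eq ?_)
      simp only [parallelLinks_capacity, parallelLinks_transitTime, mul_zero, sub_zero, zero_add]
      rw [max_eq_left hT, Finset.sum_const, Finset.card_univ, card_parallelLinks_stPath,
        nsmul_eq_mul, ← mul_assoc, mul_one_div_cancel hn', one_mul]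
  have hD : (parallelLinks n c).deadline = 1 := rfl
  rw [makespanPoA, hM, optimalMakespan, hopt.csInf_eq, hD]

theorem tendsto_parallelLinks_makespanPoA (c : (n : ℕ) → Fin n → NNReal) :
    Filter.Tendsto (fun n => (parallelLinks n (c n)).makespanPoA) Filter.atTop
      (nhds (Real.exp 1 / (Real.exp 1 - 1))) := by
  have h1 : Filter.Tendsto (fun n : ℕ => 1 / (1 - (1 + (-1) / (n : ℝ)) ^ n)) Filter.atTop
      (nhds (1 / (1 - Real.exp (-1)))) := by
    have he : Real.exp (-1) < 1 := by simp
    exact tendsto_const_nhds.div ((Real.tendsto_one_add_div_pow_exp (-1)).const_sub 1)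
      (sub_pos.2 he).ne'
  have h2 : 1 / (1 - Real.exp (-1)) = Real.exp 1 / (Real.exp 1 - 1) := by
    have he : Real.exp (-1) * Real.exp 1 = 1 := by rw [← Real.exp_add]; simp
    rw [← mul_div_mul_right 1 (1 - Real.exp (-1)) (Real.exp_pos 1).ne', one_mul, sub_mul, he,
      one_mul]
  rw [h2] at h1
  refine h1.congr' ?_
  filter_upwards [Filter.eventually_gt_atTop 0] with n hn
  rw [parallelLinks_makespanPoA hn]
  ring

end ParallelLinks

end FlowNetwork

theorem mainTheorem2 :
    (∀ (V E : Type*) [Finite E] (N : FlowNetwork V E),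
      N.IsParallelPathNetwork → (∃ P : N.STPath, P.transitTime < N.deadline) →
        IsLeast N.nashThroughputs N.minNashThroughput ∧
        IsLeast (N.feasibleMakespans N.minNashThroughput)
          (N.optimalMakespan N.minNashThroughput) ∧
        0 < N.optimalMakespan N.minNashThroughput ∧
        N.makespanPoA ≤ Real.exp 1 / (Real.exp 1 - 1)) ∧
    (∀ c : (n : ℕ) → Fin n → NNReal,
      (∀ n, (FlowNetwork.parallelLinks n (c n)).IsParallelPathNetwork) ∧
      Filter.Tendsto (fun n => (FlowNetwork.parallelLinks n (c n)).makespanPoA) Filter.atTop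
        (nhds (Real.exp 1 / (Real.exp 1 - 1)))) :=
  ⟨fun _ _ _ _ hN hD => FlowNetwork.makespanPoA_bound hN hD,
    fun c => ⟨fun _ => FlowNetwork.parallelLinks_isParallelPathNetwork,
      FlowNetwork.tendsto_parallelLinks_makespanPoA c⟩⟩
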